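/- Conventions. Locally compact groups are Hausdorff. A topological group is compactly generated if it is generated by a compact subset. A locally compact, second countable group $L$ is called a-T-menable if it admits a continuous isometric affine action on a real Hilbert space $V$ (i.e. $g\mapsto gx$ is continuous for every $x\in V$) which is metrically proper: for every $x\in V$ the displacement function $L\to\mathbb R$, $g\mapsto\|gx-x\|$, is proper. Theorem. Let $\mathfrak N$ be a locally compact, compactly generated topological group and let $G\subset\mathfrak N$ be a closed subgroup. Let $H$ be a topological group and let $i_1,i_2\colon H\to G$ be injective homomorphisms that are homeomorphisms onto open subgroups of finite index in $G$. Suppose that $i_1$ and $i_2$ are conjugated by an automorphism $\varphi$ of the topological group $\mathfrak N$, i.e. $\varphi(i_1(h))=i_2(h)$ for all $h\in H$. Let $$\Gamma=\langle G,t\mid t\,i_1(h)\,t^{-1}=i_2(h)\ \ (h\in H)\rangle$$ be the topological HNN extension (the $\mathfrak N$-BS group), i.e. the HNN extension with the finest group topology for which the canonical map $G\to\Gamma$ is continuous (equivalently, the unique group topology for which $G$ is an open topological subgroup of $\Gamma$). If $\mathfrak N$ is a-T-menable, then $\Gamma$ is locally compact, second countable and a-T-menable; if moreover $G$ is compactly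 generated, then so is $\Gamma$. In particular, for all nonzero integers $m,n$ the Baumslag–Solitar group $BS(m,n)=\langle x,t\mid t x^m t^{-1}=x^n\rangle$, as a discrete group, is (finitely generated and) a-T-menable. -/

import Mathlib

universe u

/-- A topological group is compactly generated if some compact subset generates it
(as an abstract group). -/
def IsCompactlyGeneratedGroup (G : Type u) [Group G] [TopologicalSpace G] : Prop :=
  ∃ K : Set G, IsCompact K ∧ Subgroup.closure K = ⊤

/-- An affine isometric action `α` of a topological group `G` on a Hilbert space `V` (regarded as
an affine space over itself) is continuous and metrically proper: all orbit maps are continuous,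
and for every point `x` the displacement function `g ↦ dist x (g x)` is a proper map `G → ℝ`. -/
def IsMetricallyProperAction {G V : Type u} [Group G] [TopologicalSpace G]
    [NormedAddCommGroup V] [InnerProductSpace ℝ V] (α : G →* (V ≃ᵃⁱ[ℝ] V)) : Prop :=
  ∀ x : V, Continuous (fun g : G => α g x) ∧ IsProperMap (fun g : G => dist x (α g x))

/-- A-T-menability (the Haagerup property) of a locally compact, second countable (Hausdorff)
topological group: there is a continuous, metrically proper, isometric affine action on a Hilbert
space. Since the group is second countable, the Hilbert space can always be taken
separable, so it is no restriction to look for it in the universe of the group.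
Compact generation is not part of this definition, see `IsCompactlyGeneratedGroup`. -/
structure IsATMenable (G : Type u) [Group G] [TopologicalSpace G] : Prop where
  isTopologicalGroup : IsTopologicalGroup G
  t2Space : T2Space G
  locallyCompactSpace : LocallyCompactSpace G
  secondCountableTopology : SecondCountableTopology G
  exists_action : ∃ (V : Type u) (_ : NormedAddCommGroup V) (_ : InnerProductSpace ℝ V)
    (_ : CompleteSpace V) (α : G →* (V ≃ᵃⁱ[ℝ] V)), IsMetricallyProperAction α

/-- The topology of the topological HNN extension: the finest group topology for which the
canonical homomorphism `G → HNNExtension G A B φ` is continuous. When `A` and `B` are open in `G`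
and `φ` is a homeomorphism, it is also the unique group topology for which `G` is an open
topological subgroup of the HNN extension. -/
instance HNNExtension.instTopologicalSpace {G : Type*} [Group G] [TopologicalSpace G]
    {A B : Subgroup G} {φ : A ≃* B} : TopologicalSpace (HNNExtension G A B φ) :=
  (GroupTopology.coinduced
    (HNNExtension.of : G →* HNNExtension G A B φ)).toTopologicalSpace

instance HNNExtension.instIsTopologicalGroup {G : Type*} [Group G] [TopologicalSpace G]
    {A B : Subgroup G} {φ : A ≃* B} : IsTopologicalGroup (HNNExtension G A B φ) :=
  (GroupTopology.coinduced
    (HNNExtension.of : G →* HNNExtension G A B φ)).toIsTopologicalGroup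

/-- The HNN extension `⟨G, t ∣ t i₁(h) t⁻¹ = i₂(h), h ∈ H⟩` derived from two inclusions
`i₁, i₂ : H → G`. It carries the topology of the topological HNN extension. -/
abbrev HNNOfInclusions {G H : Type*} [Group G] [Group H] (i₁ i₂ : H →* G)
    (h₁ : Function.Injective i₁) (h₂ : Function.Injective i₂) : Type _ :=
  HNNExtension G i₁.range i₂.range
    ((MonoidHom.ofInjective h₁).symm.trans (MonoidHom.ofInjective h₂))

/-- The Baumslag–Solitar group `BS(m, n) = ⟨x, t ∣ t x ^ m t⁻¹ = x ^ n⟩`, with generators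
`x = of false` and `t = of true`. -/
def BaumslagSolitar (m n : ℤ) : Type :=
  PresentedGroup ({FreeGroup.of true * FreeGroup.of false ^ m * (FreeGroup.of true)⁻¹ *
    (FreeGroup.of false ^ n)⁻¹} : Set (FreeGroup Bool))

instance BaumslagSolitar.instGroup (m n : ℤ) : Group (BaumslagSolitar m n) :=
  inferInstanceAs (Group (PresentedGroup _))

/-- Baumslag–Solitar groups are discrete groups. -/
instance BaumslagSolitar.instTopologicalSpace (m n : ℤ) :
    TopologicalSpace (BaumslagSolitar m n) := ⊥

/-! An affine isometric action on a Hilbert space is encoded by a left invariant kernel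
conditionally of negative type: the squared distance between orbit points of the origin. So it
suffices to find on Γ such a kernel, continuous at the identity, with relatively compact sublevel
sets `{γ | N 1 γ ≤ R}`. It is a sum of two kernels.

The first comes from the action of Γ on `𝔑 × ℤ` through 𝔑 ⋊ ℤ, in which G acts by translations and
the stable letter by φ and a shift. A proper action of 𝔑 gives Gaussian kernels; these are twisted
by the powers of φ, cut off by almost invariant tent functions on ℤ, and summed with constants that
force convergence. Summing over all powers makes the result invariant under 𝔑 ⋊ ℤ, while it stays
proper on 𝔑 (`exists_suspensionKernel`). This is the argument that an extension of an a-T-menable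
group by an amenable one is a-T-menable, made explicit for the quotient ℤ.

The second is the distance on the Bass–Serre tree, realised as the squared norm of a signed chain of
edges (`exists_treeKernel`). The tree is locally finite because the associated subgroups have finite
index, so a ball in Γ lies in finitely many cosets `G s`.

If the sum is bounded, the tree part leaves finitely many `s`; the element of G in front of `s` is
then confined to a compact set, because the first kernel is proper on 𝔑 and G is closed there. For
Baumslag–Solitar groups take 𝔑 = ℝ, G = ℤ and multiplication by n/m. -/

/-! ### Kernels of negative type and positive definite kernels. -/

/-- A symmetric real kernel vanishing on the diagonal is conditionally of negative type if the
associated quadratic form is nonpositive on finitely supported functions of sum zero. -/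
structure IsCondNeg {X : Type*} (N : X → X → ℝ) : Prop where
  symm : ∀ x y, N x y = N y x
  diag : ∀ x, N x x = 0
  nonpos : ∀ (s : Finset X) (c : X → ℝ), ∑ x ∈ s, c x = 0 →
    ∑ x ∈ s, ∑ y ∈ s, c x * c y * N x y ≤ 0

/-- A real kernel is positive definite if the associated quadratic form is nonnegative. -/
def IsPosKernel {X : Type*} (K : X → X → ℝ) : Prop :=
  ∀ (s : Finset X) (c : X → ℝ), 0 ≤ ∑ x ∈ s, ∑ y ∈ s, c x * c y * K x y

namespace IsCondNeg

variable {X Y : Type*} {N N' : X → X → ℝ}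

theorem add (h : IsCondNeg N) (h' : IsCondNeg N') :
    IsCondNeg fun x y => N x y + N' x y where
  symm x y := by rw [h.symm, h'.symm]
  diag x := by rw [h.diag, h'.diag, add_zero]
  nonpos s c hc := by
    simp only [mul_add, Finset.sum_add_distrib]
    exact add_nonpos (h.nonpos s c hc) (h'.nonpos s c hc)

/-- The map `p` need not be injective: coefficients are pushed forward by summing over its fibres,
which preserves their total. -/
theorem comp (h : IsCondNeg N) (p : Y → X) : IsCondNeg fun x y => N (p x) (p y) where
  symm x y := h.symm _ _
  diag x := h.diag _
  nonpos s c hc := by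
    classical
    have key := h.nonpos (s.image p) (fun x => ∑ y ∈ s with p y = x, c y) (by
      rw [← hc]
      exact Finset.sum_fiberwise_of_maps_to (fun y hy => Finset.mem_image_of_mem p hy) c)
    refine le_trans (le_of_eq ?_) key
    have h1 : ∀ F : X → ℝ, ∑ x ∈ s.image p, (∑ y ∈ s with p y = x, c y) * F x
        = ∑ y ∈ s, c y * F (p y) := by
      intro F
      rw [← Finset.sum_fiberwise_of_maps_to (g := p) (t := s.image p)
        (fun y hy => Finset.mem_image_of_mem p hy) (fun y => c y * F (p y))]
      refine Finset.sum_congr rfl fun x _ => ?_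
      rw [Finset.sum_mul]
      refine Finset.sum_congr rfl fun y hy => ?_
      rw [(Finset.mem_filter.1 hy).2]
    simp only [mul_assoc, ← Finset.mul_sum]
    rw [h1 fun x => ∑ y ∈ s.image p, (∑ z ∈ s with p z = y, c z) * N x y]
    refine Finset.sum_congr rfl fun x _ => ?_
    rw [h1 fun y => N (p x) y]

theorem tsum {ι : Type*} {N : ι → X → X → ℝ} (h : ∀ i, IsCondNeg (N i))
    (hs : ∀ x y, Summable fun i => N i x y) : IsCondNeg fun x y => ∑' i, N i x y where
  symm x y := tsum_congr fun i => (h i).symm x y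
  diag x := by simp [(h _).diag]
  nonpos s c hc := by
    have h1 : HasSum (fun i => ∑ x ∈ s, ∑ y ∈ s, c x * c y * N i x y)
        (∑ x ∈ s, ∑ y ∈ s, c x * c y * ∑' i, N i x y) :=
      hasSum_sum fun x _ => hasSum_sum fun y _ => (hs x y).hasSum.mul_left _
    exact h1.nonpos fun i => (h i).nonpos s c hc

theorem nonneg (h : IsCondNeg N) (x y : X) : 0 ≤ N x y := by
  classical
  by_cases hxy : x = y
  · rw [hxy, h.diag]
  · have h1 : y ≠ x := Ne.symm hxy
    have := h.nonpos {x, y} (fun z => if z = x then 1 else -1) (by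
      rw [Finset.sum_pair hxy]; simp [h1])
    simp only [Finset.sum_pair hxy, h1, if_true, if_false, h.diag, h.symm y x] at this
    linarith

/-- Squared differences of a real function are conditionally of negative type. -/
theorem sq_sub (p : X → ℝ) : IsCondNeg fun x y => (p x - p y) ^ 2 where
  symm x y := by ring
  diag x := by ring
  nonpos s c hc := by
    have : ∑ x ∈ s, ∑ y ∈ s, c x * c y * (p x - p y) ^ 2 =
        2 * ((∑ x ∈ s, c x * p x ^ 2) * ∑ y ∈ s, c y) - 2 * (∑ x ∈ s, c x * p x) ^ 2 := by
      have e : ∀ x y, c x * c y * (p x - p y) ^ 2 =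
        (c x * p x ^ 2) * c y + c x * (c y * p y ^ 2) - 2 * ((c x * p x) * (c y * p y)) := by
        intro x y; ring
      simp only [e, Finset.sum_sub_distrib, Finset.sum_add_distrib, ← Finset.mul_sum,
        ← Finset.sum_mul]
      ring
    rw [this, hc]
    nlinarith [sq_nonneg (∑ x ∈ s, c x * p x)]

end IsCondNeg

namespace IsPosKernel

variable {X : Type*}

/-- The squared distances of the vectors represented by a positive definite kernel. -/
theorem isCondNeg {K : X → X → ℝ} (hK : IsPosKernel K) (hsymm : ∀ x y, K x y = K y x) :
    IsCondNeg fun x y => K x x + K y y - 2 * K x y where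
  symm x y := by rw [hsymm x y]; ring
  diag x := by ring
  nonpos s c hc := by
    have : ∑ x ∈ s, ∑ y ∈ s, c x * c y * (K x x + K y y - 2 * K x y) =
        2 * ((∑ x ∈ s, c x * K x x) * ∑ y ∈ s, c y) -
          2 * ∑ x ∈ s, ∑ y ∈ s, c x * c y * K x y := by
      have e : ∀ x y, c x * c y * (K x x + K y y - 2 * K x y) =
        (c x * K x x) * c y + c x * (c y * K y y) - 2 * (c x * c y * K x y) := by
        intro x y; ring
      simp only [e, Finset.sum_sub_distrib, Finset.sum_add_distrib, ← Finset.mul_sum,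
        ← Finset.sum_mul]
      ring
    rw [this, hc]
    linarith [hK s c]

theorem mul_left_right {K : X → X → ℝ} (hK : IsPosKernel K) (a : X → ℝ) :
    IsPosKernel fun x y => a x * a y * K x y := by
  intro s c
  refine (hK s fun x => c x * a x).trans (le_of_eq ?_)
  exact Finset.sum_congr rfl fun x _ => Finset.sum_congr rfl fun y _ => by ring

theorem of_posSemidef {M : Matrix X X ℝ} (hM : M.PosSemidef) : IsPosKernel M := by
  classical
  intro s c
  have := hM.2 (Finsupp.onFinset s (fun x => if x ∈ s then c x else 0) (by
    intro x hx; by_contra h; simp [h] at hx))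
  refine this.trans (le_of_eq ?_)
  rw [Finsupp.onFinset_sum _ (by simp)]
  refine Finset.sum_congr rfl fun x hx => ?_
  rw [Finsupp.onFinset_sum _ (by simp)]
  refine Finset.sum_congr rfl fun y hy => ?_
  simp [hx, hy]
  ring

/-- Powers of a Gram matrix are positive semidefinite by the Schur product theorem, and the
exponential is a power series with nonnegative coefficients. -/
theorem exp_inner {V : Type*} [NormedAddCommGroup V] [InnerProductSpace ℝ V] (p : X → V) :
    IsPosKernel fun x y => Real.exp (inner ℝ (p x) (p y)) := by
  have h1 : ∀ n : ℕ, (Matrix.of fun x y => inner ℝ (p x) (p y) ^ n : Matrix X X ℝ).PosSemidef := by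
    have hgram : (Matrix.of fun x y => inner ℝ (p x) (p y) : Matrix X X ℝ).PosSemidef := by
      refine ⟨?_, fun f => ?_⟩
      · ext x y; simp [real_inner_comm]
      · have : 0 ≤ inner ℝ (f.sum fun x a => a • p x) (f.sum fun x a => a • p x) :=
          real_inner_self_nonneg
        refine this.trans (le_of_eq ?_)
        simp only [Finsupp.sum, sum_inner, inner_sum, inner_smul_left, inner_smul_right,
          Finset.mul_sum]
        refine Finset.sum_congr rfl fun x _ => Finset.sum_congr rfl fun y _ => ?_
        simp [real_inner_comm]; ring
    intro n
    induction n with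
    | zero =>
      refine ⟨by ext; simp, fun f => ?_⟩
      have : 0 ≤ (f.sum fun x a => a) * (f.sum fun x a => a) := mul_self_nonneg _
      refine this.trans (le_of_eq ?_)
      simp [Finsupp.sum, Finset.sum_mul_sum]
    | succ n ih =>
      have e : (Matrix.of fun x y => inner ℝ (p x) (p y) ^ (n + 1) : Matrix X X ℝ) =
          (Matrix.of fun x y => inner ℝ (p x) (p y) ^ n : Matrix X X ℝ).hadamard
            (Matrix.of fun x y => inner ℝ (p x) (p y)) := by
        ext; simp [pow_succ]
      rw [e]
      exact ih.hadamard hgram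
  intro s c
  have h2 : HasSum (fun n : ℕ => ∑ x ∈ s, ∑ y ∈ s,
      c x * c y * ((n.factorial : ℝ)⁻¹ * inner ℝ (p x) (p y) ^ n))
      (∑ x ∈ s, ∑ y ∈ s, c x * c y * Real.exp (inner ℝ (p x) (p y))) := by
    refine hasSum_sum fun x _ => hasSum_sum fun y _ => HasSum.mul_left _ ?_
    have := NormedSpace.exp_series_hasSum_exp' (𝕂 := ℝ) (inner ℝ (p x) (p y))
    rw [Real.exp_eq_exp_ℝ]
    simpa using this
  refine h2.nonneg fun n => ?_
  have := of_posSemidef (h1 n) s c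
  have e : ∑ x ∈ s, ∑ y ∈ s, c x * c y * ((n.factorial : ℝ)⁻¹ * inner ℝ (p x) (p y) ^ n) =
    (n.factorial : ℝ)⁻¹ * ∑ x ∈ s, ∑ y ∈ s, c x * c y * inner ℝ (p x) (p y) ^ n := by
    simp only [Finset.mul_sum]
    exact Finset.sum_congr rfl fun x _ => Finset.sum_congr rfl fun y _ => by ring
  rw [e]
  exact mul_nonneg (by positivity) this

/-- Gaussian kernels are positive definite. -/
theorem exp_neg_dist_sq {V : Type*} [NormedAddCommGroup V] [InnerProductSpace ℝ V] (p : X → V)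
    {s : ℝ} (hs : 0 ≤ s) : IsPosKernel fun x y => Real.exp (-s * dist (p x) (p y) ^ 2) := by
  -- Expanding the square, exp(-s‖p-q‖²) = exp(-s‖p‖²) exp(-s‖q‖²) exp(2s⟨p,q⟩); the last factor is
  -- the exponential Gram kernel of the vectors √(2s) p.
  have h := (exp_inner fun x => √(2 * s) • p x).mul_left_right
    fun x => Real.exp (-s * ‖p x‖ ^ 2)
  convert h using 3 with x y
  rw [← Real.exp_add, ← Real.exp_add, inner_smul_left, inner_smul_right, dist_eq_norm,
    norm_sub_sq_real]
  congr 1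
  have := Real.mul_self_sqrt (show 0 ≤ 2 * s by positivity)
  simp only [conj_trivial]
  linear_combination (-inner ℝ (p x) (p y)) * this

end IsPosKernel

/-! ### From kernels to affine isometric actions. -/

/-- A vector space with a positive semidefinite form and an action of a group by bijections that
preserve the associated seminorm distance maps to a Hilbert space with an affine isometric
action. -/
theorem exists_affineIsometric_action {E : Type u} [AddCommGroup E] [Module ℝ E]
    (β : E →ₗ[ℝ] E →ₗ[ℝ] ℝ) (hsymm : ∀ x y, β x y = β y x) (hpos : ∀ x, 0 ≤ β x x)
    {Γ : Type*} [Group Γ] [MulAction Γ E]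
    (hβ : ∀ (γ : Γ) (x y : E), β (γ • x - γ • y) (γ • x - γ • y) = β (x - y) (x - y)) :
    ∃ (V : Type u) (_ : NormedAddCommGroup V) (_ : InnerProductSpace ℝ V) (_ : CompleteSpace V)
      (α : Γ →* (V ≃ᵃⁱ[ℝ] V)) (ι : E →ₗ[ℝ] V), DenseRange ι ∧
      (∀ x y, dist (ι x) (ι y) ^ 2 = β (x - y) (x - y)) ∧ ∀ γ x, α γ (ι x) = ι (γ • x) := by
  let core : PreInnerProductSpace.Core ℝ E :=
    { inner := fun x y => β x y
      conj_inner_symm := fun x y => by simp [hsymm x y]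
      re_inner_nonneg := fun x => by simpa using hpos x
      add_left := fun x y z => by simp
      smul_left := fun x y r => by simp }
  let _ : SeminormedAddCommGroup E := @InnerProductSpace.Core.toSeminormedAddCommGroup ℝ E _ _ _ core
  let _ : InnerProductSpace ℝ E := InnerProductSpace.ofCore core
  have hdist : ∀ x y : E, dist x y ^ 2 = β (x - y) (x - y) := by
    intro x y
    rw [dist_eq_norm, ← real_inner_self_eq_norm_sq]
    rfl
  have hiso : ∀ γ : Γ, Isometry (fun x : E => γ • x) := fun γ =>
    Isometry.of_dist_eq fun x y => by
      rw [← sq_eq_sq₀ dist_nonneg dist_nonneg, hdist, hdist, hβ]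
  have : UniformContinuousConstSMul Γ E := ⟨fun γ => (hiso γ).uniformContinuous⟩
  let V := UniformSpace.Completion E
  have hiso' : ∀ γ : Γ, Isometry (fun x : V => γ • x) := fun γ =>
    (hiso γ).completion_map
  -- The action extends to the completion by isometric bijections, and these are affine by the
  -- Mazur–Ulam theorem, so affinity never has to be checked on `E`.
  let α : Γ →* (V ≃ᵃⁱ[ℝ] V) :=
    { toFun := fun γ => (IsometryEquiv.mk (MulAction.toPerm γ) (hiso' γ)).toRealAffineIsometryEquiv
      map_one' := by ext x; exact one_smul Γ x
      map_mul' := fun γ γ' => by ext x; exact mul_smul γ γ' x }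
  refine ⟨V, inferInstance, inferInstance, inferInstance, α,
    (UniformSpace.Completion.toComplₗᵢ : E →ₗᵢ[ℝ] V).toLinearMap,
    UniformSpace.Completion.denseRange_coe, fun x y => ?_, fun γ x => ?_⟩
  · rw [← hdist]
    exact congrArg (· ^ 2) (UniformSpace.Completion.dist_eq x y)
  · exact (UniformSpace.Completion.coe_smul γ x).symm

/-- The orbit maps of an isometric affine action are continuous as soon as those of the points
of a generating set and of the origin are. -/
theorem continuous_orbit_of_dense_span {Γ V : Type*} [Group Γ] [TopologicalSpace Γ]
    [NormedAddCommGroup V] [InnerProductSpace ℝ V] (α : Γ →* (V ≃ᵃⁱ[ℝ] V)) (S : Set V)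
    (h0 : Continuous fun γ => α γ 0) (hS : ∀ v ∈ S, Continuous fun γ => α γ v)
    (hd : Dense (Submodule.span ℝ S : Set V)) (v : V) : Continuous fun γ => α γ v := by
  let C : Submodule ℝ V :=
    { carrier := {v | Continuous fun γ => α γ v}
      zero_mem' := h0
      add_mem' := fun {v w} (hv : Continuous _) (hw : Continuous _) => by
        have e : ∀ γ, α γ (v + w) = α γ v + α γ w - α γ 0 := fun γ => by
          have h1 := (α γ).map_vadd 0 v
          have h2 := (α γ).map_vadd w v
          have h3 := (α γ).map_vadd 0 w
          simp only [vadd_eq_add, add_zero] at h1 h2 h3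
          rw [h2, h1]; abel
        change Continuous fun γ => α γ (v + w)
        simp only [e]
        exact (hv.add hw).sub h0
      smul_mem' := fun c v (hv : Continuous _) => by
        have e : ∀ γ, α γ (c • v) = c • (α γ v - α γ 0) + α γ 0 := fun γ => by
          have h1 := (α γ).map_vadd 0 v
          have h2 := (α γ).map_vadd 0 (c • v)
          simp only [vadd_eq_add, add_zero, map_smul] at h1 h2
          rw [h2, h1, add_sub_cancel_right]
        change Continuous fun γ => α γ (c • v)
        simp only [e]
        exact ((hv.sub h0).const_smul c).add h0 }
  have hSC : (Submodule.span ℝ S : Set V) ⊆ C := Submodule.span_le.2 hS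
  refine Metric.continuous_iff'.2 fun γ₀ ε hε => ?_
  obtain ⟨w, hw, hvw⟩ := hd.exists_dist_lt v (show 0 < ε / 3 by positivity)
  have hwc : Continuous fun γ => α γ w := hSC hw
  filter_upwards [Metric.continuous_iff'.1 hwc γ₀ (ε / 3) (by positivity)] with γ hγ
  have h1 : dist (α γ v) (α γ w) = dist v w := (α γ).dist_map v w
  have h2 : dist (α γ₀ w) (α γ₀ v) = dist v w := by rw [(α γ₀).dist_map, dist_comm]
  linarith [dist_triangle4 (α γ v) (α γ w) (α γ₀ w) (α γ₀ v)]

open Topology in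
/-- The affine isometric action associated with a left invariant kernel conditionally of negative
type on a topological group. -/
theorem IsCondNeg.exists_action {Γ : Type u} [Group Γ] [TopologicalSpace Γ] [IsTopologicalGroup Γ]
    {N : Γ → Γ → ℝ} (hN : IsCondNeg N) (hinv : ∀ γ x y, N (γ * x) (γ * y) = N x y)
    (hcont : ContinuousAt (fun γ => N 1 γ) 1) :
    ∃ (V : Type u) (_ : NormedAddCommGroup V) (_ : InnerProductSpace ℝ V) (_ : CompleteSpace V)
      (α : Γ →* (V ≃ᵃⁱ[ℝ] V)), (∀ x, Continuous fun γ => α γ x) ∧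
      ∀ γ, dist 0 (α γ 0) ^ 2 = N 1 γ := by
  classical
  let σ : (Γ →₀ ℝ) →ₗ[ℝ] ℝ := Finsupp.linearCombination ℝ fun _ => (1 : ℝ)
  have hσ : ∀ f, σ f = ∑ x ∈ f.support, f x := fun f => by
    simp [σ, Finsupp.linearCombination_apply, Finsupp.sum]
  let E : Submodule ℝ (Γ →₀ ℝ) := LinearMap.ker σ
  -- With the factor -1/2 the squared length of δ_x - δ_y is exactly `N x y`. The form is
  -- nonnegative only on the sum-zero space `E`.
  let B : (Γ →₀ ℝ) →ₗ[ℝ] (Γ →₀ ℝ) →ₗ[ℝ] ℝ :=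
    Finsupp.linearCombination ℝ fun x => Finsupp.linearCombination ℝ fun y => -(N x y) / 2
  have hB : ∀ f g, B f g = f.sum fun x a => g.sum fun y b => a * (b * (-(N x y) / 2)) := by
    intro f g
    simp [B, Finsupp.linearCombination_apply, Finsupp.sum, LinearMap.sum_apply, Finset.mul_sum]
  let β : E →ₗ[ℝ] E →ₗ[ℝ] ℝ := B.domRestrict₁₂ E E
  have hBsymm : ∀ f g, B f g = B g f := by
    intro f g
    rw [hB, hB, Finsupp.sum_comm]
    refine Finsupp.sum_congr fun x _ => Finsupp.sum_congr fun y _ => ?_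
    rw [hN.symm]; ring
  have hBpos : ∀ f ∈ E, 0 ≤ B f f := by
    intro f hf
    have h1 : ∑ x ∈ f.support, f x = 0 := by
      rw [← hσ]; exact hf
    have h2 := hN.nonpos f.support f h1
    rw [hB]
    have e : (f.sum fun x a => f.sum fun y b => a * (b * (-(N x y) / 2))) =
        -(∑ x ∈ f.support, ∑ y ∈ f.support, f x * f y * N x y) / 2 := by
      simp only [Finsupp.sum, ← Finset.sum_neg_distrib, Finset.sum_div]
      exact Finset.sum_congr rfl fun x _ => Finset.sum_congr rfl fun y _ => by ring
    rw [e]; linarith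
  let L : Γ → (Γ →₀ ℝ) →ₗ[ℝ] (Γ →₀ ℝ) := fun γ => Finsupp.lmapDomain ℝ ℝ (γ * ·)
  have hσL : ∀ γ f, σ (L γ f) = σ f := by
    intro γ f
    simp only [σ, L, Finsupp.lmapDomain_apply, Finsupp.linearCombination_mapDomain]
    rfl
  have hBL : ∀ γ f g, B (L γ f) (L γ g) = B f g := by
    intro γ f g
    have : B.compl₁₂ (L γ) (L γ) = B := by
      ext x y
      simp [B, L, hinv]
    exact LinearMap.congr_fun₂ this f g
  let δ : Γ → (Γ →₀ ℝ) := fun γ => Finsupp.single γ 1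
  have hσδ : ∀ γ, σ (δ γ) = 1 := fun γ => by simp [σ, δ]
  have hLδ : ∀ γ γ', L γ (δ γ') = δ (γ * γ') := fun γ γ' => by simp [L, δ]
  have hL1 : ∀ f, L 1 f = f := fun f => by
    have : L 1 = LinearMap.id := by ext; simp [L]
    rw [this]; rfl
  have hLmul : ∀ γ γ' f, L (γ * γ') f = L γ (L γ' f) := fun γ γ' f => by
    have : L (γ * γ') = (L γ).comp (L γ') := by ext; simp [L, mul_assoc]
    rw [this]; rfl
  -- Left translation fixing the origin is corrected by the cocycle δ_γ - δ_1, as if δ_1 were the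
  -- origin of the affine hyperplane of functions of sum one.
  let _ : MulAction Γ E :=
    { smul := fun γ f => ⟨L γ f + (δ γ - δ 1), by
        change σ _ = 0
        rw [map_add, map_sub, hσL, hσδ, hσδ, sub_self, add_zero]
        exact f.2⟩
      one_smul := fun f => Subtype.ext (by
        change L 1 f + (δ 1 - δ 1) = f
        rw [hL1, sub_self, add_zero])
      mul_smul := fun γ γ' f => Subtype.ext (by
        change L (γ * γ') f + (δ (γ * γ') - δ 1) = L γ (L γ' f + (δ γ' - δ 1)) + (δ γ - δ 1)
        rw [map_add, map_sub, hLδ, hLδ, mul_one, hLmul]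
        abel) }
  have hsmul : ∀ (γ : Γ) (f : E), ((γ • f : E) : Γ →₀ ℝ) = L γ f + (δ γ - δ 1) := fun _ _ => rfl
  obtain ⟨V, i1, i2, i3, α, ι, hdense, hdist, hact⟩ :=
    exists_affineIsometric_action (E := E) (Γ := Γ) β (fun x y => hBsymm x y) (fun x => hBpos x x.2)
      (fun γ x y => by
        change B ((γ • x : E) - (γ • y : E)) ((γ • x : E) - (γ • y : E)) = B (x - y) (x - y)
        rw [hsmul, hsmul, add_sub_add_right_eq_sub, ← map_sub, hBL])
  have hd : ∀ γ γ', dist (α γ 0) (α γ' 0) ^ 2 = N γ γ' := by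
    intro γ γ'
    have h0 : ∀ γ, α γ 0 = ι (γ • 0) := fun γ => by rw [← hact, map_zero ι]
    rw [h0, h0, hdist]
    change B ((γ • 0 : E) - (γ' • 0 : E)) ((γ • 0 : E) - (γ' • 0 : E)) = N γ γ'
    rw [hsmul, hsmul]
    simp only [Submodule.coe_zero, map_zero, zero_add, sub_sub_sub_cancel_right]
    simp [B, δ, hN.diag, hN.symm γ' γ]
    ring
  have hc0 : Continuous fun γ => α γ 0 := by
    refine continuous_iff_continuousAt.2 fun γ₀ => ?_
    rw [ContinuousAt, tendsto_iff_dist_tendsto_zero]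
    have h1 : Filter.Tendsto (fun γ => N 1 (γ₀⁻¹ * γ)) (𝓝 γ₀) (𝓝 0) := by
      have h2 : Filter.Tendsto (fun γ => γ₀⁻¹ * γ) (𝓝 γ₀) (𝓝 1) := by
        have : Continuous fun γ => γ₀⁻¹ * γ := by fun_prop
        simpa using this.tendsto γ₀
      have h3 := hcont.tendsto.comp h2
      rwa [hN.diag] at h3
    have h4 : ∀ γ, dist (α γ 0) (α γ₀ 0) = √(N 1 (γ₀⁻¹ * γ)) := fun γ => by
      have : N 1 (γ₀⁻¹ * γ) = N γ₀ γ := by rw [← hinv γ₀]; simp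
      rw [this, ← hd, Real.sqrt_sq dist_nonneg, dist_comm]
    simp only [h4]
    simpa using h1.sqrt
  refine ⟨V, i1, i2, i3, α, ?_, fun γ => ?_⟩
  · refine continuous_orbit_of_dense_span α (Set.range fun γ => α γ 0) hc0 ?_ ?_
    · rintro _ ⟨γ', rfl⟩
      have : ∀ γ, α γ (α γ' 0) = α (γ * γ') 0 := fun γ => by rw [map_mul]; rfl
      simp only [this]
      exact hc0.comp (by fun_prop : Continuous fun γ => γ * γ')
    · refine hdense.mono ?_
      rintro _ ⟨f, rfl⟩
      have hb : ∀ γ, δ γ - δ 1 ∈ E := fun γ => by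
        change σ _ = 0
        rw [map_sub, hσδ, hσδ, sub_self]
      -- A sum-zero function is a combination of the vectors δ_x - δ_1, which are the orbit points
      -- of the origin; hence the orbit spans a dense subspace.
      have hf : f = ∑ x ∈ (f : Γ →₀ ℝ).support, (f : Γ →₀ ℝ) x • (⟨δ x - δ 1, hb x⟩ : E) := by
        apply Subtype.ext
        rw [Submodule.coe_sum]
        have h1 : ∑ x ∈ (f : Γ →₀ ℝ).support, (f : Γ →₀ ℝ) x = 0 := by
          rw [← hσ]; exact f.2
        simp only [Submodule.coe_smul, smul_sub, Finset.sum_sub_distrib, ← Finset.sum_smul, h1,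
          zero_smul, sub_zero]
        have := Finsupp.sum_single (f : Γ →₀ ℝ)
        simpa [Finsupp.sum, δ] using this.symm
      rw [hf, map_sum]
      refine Submodule.sum_mem _ fun x _ => ?_
      rw [map_smul]
      refine Submodule.smul_mem _ _ (Submodule.subset_span ⟨x, ?_⟩)
      change α x 0 = _
      rw [← map_zero ι, hact]
      congr 1
      apply Subtype.ext
      rw [hsmul]
      simp
  · rw [← hd]
    simp

/-! ### The topology of the HNN extension. -/

namespace HNNExtension

open Filter Topology

theorem continuous_of {G : Type*} [Group G] [TopologicalSpace G] {A B : Subgroup G} {φ : A ≃* B} :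
    Continuous (of : G →* HNNExtension G A B φ) :=
  GroupTopology.coinduced_continuous _

variable {G : Type*} [Group G] [TopologicalSpace G] [IsTopologicalGroup G]
  {A B : Subgroup G} {φ : A ≃* B}

/-- Conjugation by any element of the HNN extension preserves the filter of neighbourhoods of the
identity of the base group. -/
theorem tendsto_conj_map_of_nhds_one (hA : IsOpen (A : Set G)) (hB : IsOpen (B : Set G))
    (hφ : Continuous φ) (hφ' : Continuous φ.symm) (γ : HNNExtension G A B φ) :
    Tendsto (γ * · * γ⁻¹) (map (of : G →* HNNExtension G A B φ) (𝓝 1))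
      (map (of : G →* HNNExtension G A B φ) (𝓝 1)) := by
  -- As `A` and `B` are open, neighbourhoods of 1 in `G` can be computed inside either of them,
  -- where conjugation by `t` is φ.
  have eA : map (fun a : A => (of (a : G) : HNNExtension G A B φ)) (𝓝 1) = map of (𝓝 1) := by
    rw [← A.coe_one, ← hA.isOpenEmbedding_subtypeVal.map_nhds_eq (1 : A), map_map]; rfl
  have eB : map (fun b : B => (of (b : G) : HNNExtension G A B φ)) (𝓝 1) = map of (𝓝 1) := by
    rw [← B.coe_one, ← hB.isOpenEmbedding_subtypeVal.map_nhds_eq (1 : B), map_map]; rfl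
  -- Treating γ and its inverse together makes the induction closed under inversion.
  suffices h : Tendsto (γ * · * γ⁻¹) (map (of : G →* HNNExtension G A B φ) (𝓝 1))
      (map (of : G →* HNNExtension G A B φ) (𝓝 1)) ∧
      Tendsto (γ⁻¹ * · * γ) (map (of : G →* HNNExtension G A B φ) (𝓝 1))
      (map (of : G →* HNNExtension G A B φ) (𝓝 1)) from h.1
  induction γ using induction_on with
  | of g =>
    have key : ∀ g : G, Tendsto (of g * · * (of g)⁻¹)
        (map (of : G →* HNNExtension G A B φ) (𝓝 1))
        (map (of : G →* HNNExtension G A B φ) (𝓝 1)) := by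
      intro g
      rw [tendsto_map'_iff]
      have h1 : Tendsto (fun x : G => g * x * g⁻¹) (𝓝 1) (𝓝 1) := by
        have : Continuous fun x : G => g * x * g⁻¹ := by fun_prop
        simpa using this.tendsto 1
      convert! tendsto_map.comp h1 using 1
      ext; simp
    exact ⟨key g, by simpa using key g⁻¹⟩
  | t =>
    constructor
    · nth_rewrite 1 [← eA]
      rw [← eB, tendsto_map'_iff]
      have h1 : Tendsto φ (𝓝 1) (𝓝 1) := by simpa using hφ.tendsto 1
      convert! tendsto_map.comp h1 using 1
      ext a; simp [equiv_eq_conj]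
    · nth_rewrite 1 [← eB]
      rw [← eA, tendsto_map'_iff]
      have h1 : Tendsto φ.symm (𝓝 1) (𝓝 1) := by simpa using hφ'.tendsto 1
      convert! tendsto_map.comp h1 using 1
      ext a; simp [equiv_symm_eq_conj]
  | mul x y hx hy =>
    constructor
    · convert! hx.1.comp hy.1 using 1
      ext; simp [mul_assoc]
    · convert! hy.2.comp hx.2 using 1
      ext; simp [mul_assoc]
  | inv x hx => exact ⟨by simpa using hx.2, by simpa using hx.1⟩

/-- The base group is an open topological subgroup of the topological HNN extension. -/
theorem isOpenEmbedding_of (hA : IsOpen (A : Set G)) (hB : IsOpen (B : Set G))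
    (hφ : Continuous φ) (hφ' : Continuous φ.symm) :
    IsOpenEmbedding (of : G →* HNNExtension G A B φ) := by
  refine .of_continuous_injective_isOpenMap continuous_of (of_injective φ) ?_
  -- The topology τ takes the left translates of the neighbourhoods of 1 in `G` as neighbourhoods;
  -- it visibly makes `G` open, so it remains to see that τ is a group topology.
  let n : HNNExtension G A B φ → Filter (HNNExtension G A B φ) :=
    fun x => map (x * ·) (map of (𝓝 1))
  let τ : TopologicalSpace (HNNExtension G A B φ) := TopologicalSpace.mkOfNhds n
  have hτ : ∀ x, @nhds _ τ x = n x := by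
    refine fun x => TopologicalSpace.nhds_mkOfNhds n x ?_ ?_
    · intro x s hs
      have : (x * of (1 : G)) ∈ s := mem_of_mem_nhds (s := {g : G | x * of g ∈ s}) hs
      simpa using this
    · intro x s hs
      have hs' : ∀ᶠ g in 𝓝 (1 : G), x * of g ∈ s := hs
      change ∀ᶠ g in 𝓝 (1 : G), ∀ᶠ g' in 𝓝 (1 : G), x * of g * of g' ∈ s
      filter_upwards [hs'.eventually_nhds] with g hg
      have h1 : Tendsto (fun g' : G => g * g') (𝓝 1) (𝓝 g) := by
        have : Continuous fun g' : G => g * g' := by fun_prop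
        simpa using this.tendsto 1
      filter_upwards [h1.eventually hg] with g' hg'
      simpa [mul_assoc] using hg'
  have hτ1 : @nhds _ τ 1 = map of (𝓝 1) := by
    rw [hτ]; simp [n, Function.comp_def]
  have hgrp : @IsTopologicalGroup _ τ _ := by
    refine @IsTopologicalGroup.of_nhds_one _ _ τ ?_ ?_ ?_ ?_
    · rw [hτ1, prod_map_map_eq, tendsto_map'_iff]
      have h1 : Tendsto (fun p : G × G => p.1 * p.2) (𝓝 1 ×ˢ 𝓝 1) (𝓝 1) := by
        rw [← nhds_prod_eq]
        simpa using (continuous_mul (M := G)).tendsto (1, 1)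
      convert! tendsto_map.comp h1 using 1
      ext; simp
    · rw [hτ1, tendsto_map'_iff]
      have h1 : Tendsto (fun g : G => g⁻¹) (𝓝 1) (𝓝 1) := by
        simpa using (continuous_inv (G := G)).tendsto 1
      convert! tendsto_map.comp h1 using 1
      ext; simp
    · intro x
      rw [hτ1, hτ]
    · intro x
      rw [hτ1]
      exact tendsto_conj_map_of_nhds_one hA hB hφ hφ' x
  have hcont : @Continuous _ _ _ τ (of : G →* HNNExtension G A B φ) := by
    refine @continuous_of_continuousAt_one _ _ _ _ _ _ _ τ hgrp.toContinuousMul _ _ of ?_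
    change Tendsto _ _ (@nhds _ τ _)
    rw [map_one, hτ1]
    exact tendsto_map
  -- The given topology is the finest group topology making `of` continuous, so every τ-open set is
  -- open for it.
  have hle : (instTopologicalSpace : TopologicalSpace (HNNExtension G A B φ)) ≤ τ :=
    GroupTopology.toTopologicalSpace_le.2 (sInf_le (a := (⟨τ, hgrp⟩ : GroupTopology _))
      (continuous_iff_coinduced_le.1 hcont))
  intro U hU
  refine IsOpen.mono ?_ hle
  refine (@isOpen_iff_mem_nhds _ τ _).2 ?_
  rintro _ ⟨g, hg, rfl⟩
  rw [hτ]
  change ∀ᶠ g' in 𝓝 (1 : G), of g * of g' ∈ of '' U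
  have h1 : Tendsto (fun g' : G => g * g') (𝓝 1) (𝓝 g) := by
    have : Continuous fun g' : G => g * g' := by fun_prop
    simpa using this.tendsto 1
  filter_upwards [h1.eventually (hU.mem_nhds hg)] with g' hg'
  exact ⟨g * g', hg', map_mul _ _ _⟩

end HNNExtension

/-- A topological group with a Hausdorff open subgroup is Hausdorff. -/
theorem t2Space_of_isOpenEmbedding_monoidHom {G Γ : Type*} [Group G] [TopologicalSpace G]
    [Group Γ] [TopologicalSpace Γ] [IsTopologicalGroup Γ] [T2Space G] (f : G →* Γ)
    (hf : Topology.IsOpenEmbedding f) : T2Space Γ := by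
  refine IsTopologicalGroup.t2Space_of_one_sep fun x hx => ?_
  by_cases h : x ∈ Set.range f
  · obtain ⟨g, rfl⟩ := h
    have hg : (1 : G) ≠ g := fun h => hx (by rw [← h, map_one])
    refine ⟨f '' {g}ᶜ, ?_, ?_⟩
    · exact (hf.isOpenMap _ isOpen_compl_singleton).mem_nhds ⟨1, hg, map_one f⟩
    · rintro ⟨g', hg', h⟩
      exact hg' (hf.injective h)
  · exact ⟨Set.range f, hf.isOpen_range.mem_nhds ⟨1, map_one f⟩, h⟩

/-- A topological group with a locally compact open subgroup is locally compact. -/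
theorem locallyCompactSpace_of_isOpenEmbedding_monoidHom {G Γ : Type*} [Group G]
    [TopologicalSpace G] [Group Γ] [TopologicalSpace Γ] [IsTopologicalGroup Γ]
    [LocallyCompactSpace G] (f : G →* Γ) (hf : Topology.IsOpenEmbedding f) :
    LocallyCompactSpace Γ := by
  obtain ⟨K, hK, hK1⟩ := exists_compact_mem_nhds (1 : G)
  refine (hK.image hf.continuous).locallyCompactSpace_of_mem_nhds_of_group (x := 1) ?_
  rw [← map_one f]
  exact hf.isOpenMap.image_mem_nhds hK1

/-- A topological group covered by countably many right translates of a second countable open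
subgroup is second countable. -/
theorem secondCountableTopology_of_isOpenEmbedding_monoidHom {G Γ : Type*} [Group G]
    [TopologicalSpace G] [Group Γ] [TopologicalSpace Γ] [IsTopologicalGroup Γ]
    [SecondCountableTopology G] (f : G →* Γ) (hf : Topology.IsOpenEmbedding f) (S : Set Γ)
    (hS : S.Countable) (hcover : ∀ γ, ∃ g, ∃ s ∈ S, γ = f g * s) :
    SecondCountableTopology Γ := by
  have := hS.to_subtype
  have he : ∀ s : Γ, Topology.IsOpenEmbedding fun g => f g * s := fun s =>
    (Homeomorph.mulRight s).isOpenEmbedding.comp hf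
  have : ∀ s : S, SecondCountableTopology (Set.range fun g => f g * (s : Γ)) := fun s =>
    ((he s).isEmbedding.toHomeomorph.symm).secondCountableTopology
  refine TopologicalSpace.secondCountableTopology_of_countable_cover
    (U := fun s : S => Set.range fun g => f g * (s : Γ)) (fun s => (he s).isOpen_range) ?_
  refine Set.eq_univ_of_forall fun γ => ?_
  obtain ⟨g, s, hs, rfl⟩ := hcover γ
  exact Set.mem_iUnion.2 ⟨⟨s, hs⟩, g, rfl⟩

/-! ### The Bass–Serre tree and its distance kernel. -/

namespace HNNExtension

variable {G : Type*} [Group G] {A B : Subgroup G} {φ : A ≃* B}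

section Edges

variable (φ)

/-- The edges of the Bass–Serre tree, as cosets of the second associated subgroup. -/
abbrev Edge : Type _ := HNNExtension G A B φ ⧸ B.map (of : G →* HNNExtension G A B φ)

/-- The permutation representation on finite chains of edges of the Bass–Serre tree. -/
noncomputable def chainRep (γ : HNNExtension G A B φ) : (Edge φ →₀ ℝ) ≃ₗ[ℝ] (Edge φ →₀ ℝ) :=
  Finsupp.domLCongr (MulAction.toPerm γ)

theorem chainRep_single (γ : HNNExtension G A B φ) (q : Edge φ) (a : ℝ) :
    chainRep φ γ (Finsupp.single q a) = Finsupp.single (γ • q) a := by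
  simp [chainRep]

theorem chainRep_mul (γ γ' : HNNExtension G A B φ) (x : Edge φ →₀ ℝ) :
    chainRep φ (γ * γ') x = chainRep φ γ (chainRep φ γ' x) := by
  have : (chainRep φ (γ * γ')).toLinearMap =
      (chainRep φ γ).toLinearMap.comp (chainRep φ γ').toLinearMap := by
    ext q : 2
    simp [chainRep_single, mul_smul]
  exact LinearMap.congr_fun this x

theorem chainRep_one (x : Edge φ →₀ ℝ) : chainRep φ 1 x = x := by
  have : (chainRep φ 1).toLinearMap = LinearMap.id := by
    ext q : 2
    simp [chainRep_single]
  exact LinearMap.congr_fun this x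

/-- This makes the affine action below respect the defining relation: `t * of a` and `of (φ a) * t`
have the same translation part because `φ a` fixes the edge crossed by `t`. -/
theorem of_smul_edge_one (b : B) :
    (of (b : G) : HNNExtension G A B φ) • (QuotientGroup.mk 1 : Edge φ) = QuotientGroup.mk 1 := by
  rw [MulAction.Quotient.smul_mk, smul_eq_mul, mul_one, QuotientGroup.eq]
  simpa using ⟨b, b.2, rfl⟩

/-- The affine action on chains of edges for which the stable letter moves the origin to the edge
it crosses. -/
noncomputable def chainAction : HNNExtension G A B φ →* Equiv.Perm (Edge φ →₀ ℝ) :=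
  lift
    { toFun := fun g => (chainRep φ (of g)).toEquiv
      map_one' := by ext1 x; simpa using chainRep_one φ x
      map_mul' := fun g g' => by ext1 x; simpa using chainRep_mul φ (of g) (of g') x }
    ((chainRep φ t).toEquiv.trans (Equiv.addRight (Finsupp.single (QuotientGroup.mk 1) 1)))
    (fun a => by
      ext1 x
      simp only [MonoidHom.coe_mk, OneHom.coe_mk, Equiv.Perm.coe_mul, Function.comp_apply,
        Equiv.trans_apply, LinearEquiv.coe_toEquiv, Equiv.coe_addRight, map_add]
      rw [← chainRep_mul, ← chainRep_mul, t_mul_of, chainRep_single, of_smul_edge_one])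

theorem chainAction_of (g : G) (x : Edge φ →₀ ℝ) :
    chainAction φ (of g) x = chainRep φ (of g) x := by
  simp [chainAction]

theorem chainAction_t (x : Edge φ →₀ ℝ) :
    chainAction φ t x = chainRep φ t x + Finsupp.single (QuotientGroup.mk 1) 1 := by
  simp [chainAction]

theorem chainAction_sub (γ : HNNExtension G A B φ) (x y : Edge φ →₀ ℝ) :
    chainAction φ γ x - chainAction φ γ y = chainRep φ γ (x - y) := by
  induction γ using induction_on generalizing x y with
  | of g => simp [chainAction_of]
  | t => simp [chainAction_t]
  | mul γ γ' h h' => simp [h, h', chainRep_mul]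
  | inv γ h =>
    have e : ∀ z, chainAction φ γ (chainAction φ γ⁻¹ z) = z := fun z => by
      rw [map_inv]; exact Equiv.apply_symm_apply _ z
    apply (chainRep φ γ).injective
    rw [← h, ← chainRep_mul, mul_inv_cancel, chainRep_one, e, e]

/-- The signed chain of edges between the base vertex and its image. -/
noncomputable def pathChain (γ : HNNExtension G A B φ) : Edge φ →₀ ℝ := chainAction φ γ 0

theorem pathChain_mul (γ γ' : HNNExtension G A B φ) :
    pathChain φ (γ * γ') = pathChain φ γ + chainRep φ γ (pathChain φ γ') := by
  have := chainAction_sub φ γ (pathChain φ γ') 0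
  rw [sub_zero] at this
  rw [← this]
  simp [pathChain]

@[simp]
theorem pathChain_of (g : G) : pathChain φ (of g) = 0 := by
  simp [pathChain, chainAction_of]

@[simp]
theorem pathChain_one : pathChain φ 1 = 0 := by
  simp [pathChain]

/-- The edge crossed by the stable letter or by its inverse. -/
def letterEdge (u : ℤˣ) : Edge φ := if u = 1 then QuotientGroup.mk 1 else QuotientGroup.mk t⁻¹

theorem pathChain_zpow (u : ℤˣ) :
    pathChain φ (t ^ (u : ℤ)) = Finsupp.single (letterEdge φ u) ((u : ℤ) : ℝ) := by
  have ht : pathChain φ t = Finsupp.single (QuotientGroup.mk 1) 1 := by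
    simp [pathChain, chainAction_t]
  rcases Int.units_eq_one_or u with rfl | rfl
  · simp [letterEdge, ht]
  · have h := pathChain_mul φ t⁻¹ t
    rw [inv_mul_cancel, pathChain_one, ht, chainRep_single] at h
    have h1 : (-1 : ℤˣ) ≠ 1 := by decide
    simp only [Units.val_neg, Units.val_one, zpow_neg, zpow_one, letterEdge, h1, if_false]
    rw [eq_neg_of_add_eq_zero_left h.symm, ← Finsupp.single_neg, MulAction.Quotient.smul_mk]
    simp

/-- The standard inner product on chains of edges. -/
noncomputable def chainInner : (Edge φ →₀ ℝ) →ₗ[ℝ] (Edge φ →₀ ℝ) →ₗ[ℝ] ℝ :=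
  Finsupp.linearCombination ℝ fun q => Finsupp.lapply q

theorem chainInner_self (x : Edge φ →₀ ℝ) : chainInner φ x x = ∑ q ∈ x.support, x q ^ 2 := by
  simp [chainInner, Finsupp.linearCombination_apply, Finsupp.sum, LinearMap.sum_apply, sq]

open Classical in
theorem chainInner_single (q q' : Edge φ) (a b : ℝ) :
    chainInner φ (Finsupp.single q a) (Finsupp.single q' b) = if q = q' then a * b else 0 := by
  simp [chainInner, Finsupp.single_apply, eq_comm]

theorem chainInner_comm (x y : Edge φ →₀ ℝ) : chainInner φ x y = chainInner φ y x := by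
  classical
  have : chainInner φ = (chainInner φ).flip := by
    ext q q'
    simp [chainInner_single, eq_comm]
  exact LinearMap.congr_fun₂ this x y

theorem chainInner_chainRep (γ : HNNExtension G A B φ) (x y : Edge φ →₀ ℝ) :
    chainInner φ (chainRep φ γ x) (chainRep φ γ y) = chainInner φ x y := by
  classical
  have : (chainInner φ).compl₁₂ (chainRep φ γ).toLinearMap (chainRep φ γ).toLinearMap =
      chainInner φ := by
    ext q q'
    simp [chainInner_single, chainRep_single]
  exact LinearMap.congr_fun₂ this x y

/-- The element spelled by a list of syllables. -/
def syllables (l : List (ℤˣ × G)) : HNNExtension G A B φ :=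
  (l.map fun x => t ^ (x.1 : ℤ) * of x.2).prod

@[simp]
theorem syllables_nil : syllables φ [] = 1 := by simp [syllables]

@[simp]
theorem syllables_cons (x : ℤˣ × G) (l : List (ℤˣ × G)) :
    syllables φ (x :: l) = t ^ (x.1 : ℤ) * of x.2 * syllables φ l := by simp [syllables]

@[simp]
theorem syllables_append (l l' : List (ℤˣ × G)) :
    syllables φ (l ++ l') = syllables φ l * syllables φ l' := by simp [syllables]

variable (A B) in
/-- A list of syllables without pinches. -/
def IsReducedList (l : List (ℤˣ × G)) : Prop :=
  l.IsChain fun a b => a.2 ∈ toSubgroup A B a.1 → a.1 = b.1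

/-- Britton's lemma: a nonempty reduced list of syllables does not spell an element of the base
group. -/
theorem IsReducedList.eq_nil_of_mul_eq_of {l : List (ℤˣ × G)} (hl : IsReducedList A B l)
    (g g' : G) (h : of g * syllables φ l = of g') : l = [] :=
  ReducedWord.toList_eq_nil_of_mem_of_range φ ⟨g, l, hl⟩ ⟨g', h.symm⟩

/-- A reduced path never crosses an edge back in the opposite direction. Equality of the two edges
would put the subword between the crossings, with or without the two letters according to the sign,
in the base group, against Britton's lemma or the absence of pinches. -/
theorem letterEdge_ne {u : ℤˣ} {g g' : G} {l : List (ℤˣ × G)}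
    (hl : IsReducedList A B ((u, g) :: (l ++ [(-u, g')]))) :
    letterEdge φ u ≠ (t ^ (u : ℤ) * of g * syllables φ l) • letterEdge φ (-u) := by
  have h1 : (-1 : ℤˣ) ≠ 1 := by decide
  intro h
  rcases Int.units_eq_one_or u with rfl | rfl
  · simp only [letterEdge, h1, if_true, if_false] at h
    rw [MulAction.Quotient.smul_mk, smul_eq_mul, QuotientGroup.eq] at h
    obtain ⟨b, -, hb⟩ := h
    -- Reducedness does not see the base element of the last syllable, so it may be replaced by 1.
    have hl' : IsReducedList A B ((1, g) :: (l ++ [(-1, 1)])) := by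
      have := List.isChain_append.1 (show List.IsChain _ (((1, g) :: l) ++ [(-1, g')]) from hl)
      change List.IsChain _ (((1, g) :: l) ++ [(-1, 1)])
      refine List.isChain_append.2 ⟨this.1, List.isChain_singleton _, ?_⟩
      intro x hx y hy
      simp only [List.head?_cons, Option.mem_def, Option.some.injEq] at hy
      subst hy
      exact this.2.2 x hx (-1, g') rfl
    have := hl'.eq_nil_of_mul_eq_of φ 1 b (by rw [hb]; simp [mul_assoc])
    simp at this
  · simp only [letterEdge, h1, neg_neg, if_true, if_false] at h
    rw [MulAction.Quotient.smul_mk, smul_eq_mul, QuotientGroup.eq] at h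
    obtain ⟨b, hbB, hb⟩ := h
    have hl1 : IsReducedList A B (l ++ [(1, g')]) := by
      simpa only [neg_neg] using! (List.isChain_cons.1 hl).2
    have hb' : of g * syllables φ l = of b := by
      rw [hb]; simp [mul_assoc]
    have hnil := IsReducedList.eq_nil_of_mul_eq_of φ (List.isChain_append.1 hl1).1 g b hb'
    subst hnil
    have hgb : g = b := of_injective φ (by simpa using hb')
    have := (List.isChain_cons.1 hl).1 (1, g') (by simp) (by
      simp only [toSubgroup_neg_one, hgb]; exact hbB)
    exact h1 this

theorem pathChain_syllables_cons (x : ℤˣ × G) (l : List (ℤˣ × G)) :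
    pathChain φ (syllables φ (x :: l)) = pathChain φ (t ^ (x.1 : ℤ)) +
      chainRep φ (t ^ (x.1 : ℤ) * of x.2) (pathChain φ (syllables φ l)) := by
  rw [syllables_cons, pathChain_mul, pathChain_mul, pathChain_of]
  simp

/-- Crossings with equal signs contribute 0 or 1, and crossings with opposite signs are on distinct
edges, hence orthogonal. -/
theorem chainInner_letter_nonneg {u : ℤˣ} {g : G} (l₂ : List (ℤˣ × G)) :
    ∀ l₁ : List (ℤˣ × G), IsReducedList A B ((u, g) :: (l₁ ++ l₂)) →
      0 ≤ chainInner φ (pathChain φ (t ^ (u : ℤ)))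
        (chainRep φ (t ^ (u : ℤ) * of g * syllables φ l₁) (pathChain φ (syllables φ l₂))) := by
  classical
  induction l₂ with
  | nil => intro l₁ _; simp
  | cons x l₂ ih =>
    intro l₁ hl
    rw [pathChain_syllables_cons, map_add, map_add, ← chainRep_mul]
    refine add_nonneg ?_ ?_
    · rw [pathChain_zpow, pathChain_zpow, chainRep_single, chainInner_single]
      by_cases hx : x.1 = u
      · split_ifs
        · rw [hx]; exact mul_self_nonneg _
        · exact le_rfl
      · rw [if_neg]
        obtain ⟨v, g'⟩ := x
        obtain rfl : v = -u := Int.units_ne_iff_eq_neg.1 hx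
        refine letterEdge_ne (g' := g') φ ?_
        have : (u, g) :: (l₁ ++ (-u, g') :: l₂) = ((u, g) :: (l₁ ++ [(-u, g')])) ++ l₂ := by simp
        rw [this] at hl
        exact (List.isChain_append.1 hl).1
    · have := ih (l₁ ++ [x]) (by simpa using hl)
      simpa [mul_assoc] using this

/-- Adding a syllable adds a unit vector e to an isometric copy of the old chain v, and ‖e + v‖² ≥ 1
+ ‖v‖² since the cross term is nonnegative. -/
theorem length_le_chainInner (l : List (ℤˣ × G)) (hl : IsReducedList A B l) :
    (l.length : ℝ) ≤ chainInner φ (pathChain φ (syllables φ l)) (pathChain φ (syllables φ l)) := by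
  classical
  induction l with
  | nil => simp
  | cons x l ih =>
    have h1 := ih (List.isChain_cons.1 hl).2
    have h2 := chainInner_letter_nonneg φ l [] hl
    have h3 : chainInner φ (pathChain φ (t ^ (x.1 : ℤ))) (pathChain φ (t ^ (x.1 : ℤ))) = 1 := by
      rw [pathChain_zpow, chainInner_single, if_pos rfl]
      rcases Int.units_eq_one_or x.1 with h | h <;> simp [h]
    rw [syllables_nil, mul_one] at h2
    rw [pathChain_syllables_cons]
    simp only [map_add, LinearMap.add_apply, h3, chainInner_chainRep]
    rw [chainInner_comm φ (chainRep φ _ _)]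
    push_cast [List.length_cons]
    linarith

theorem exists_finite_syllables (T : Set (ℤˣ × G)) (hT : T.Finite) (n : ℕ) :
    ∃ S : Set (HNNExtension G A B φ), S.Finite ∧
      ∀ l : List (ℤˣ × G), l.length ≤ n → (∀ x ∈ l, x ∈ T) → syllables φ l ∈ S := by
  induction n with
  | zero => exact ⟨{1}, Set.finite_singleton 1, fun l hl _ => by
      rw [List.length_eq_zero_iff.1 (Nat.le_zero.1 hl)]; simp⟩
  | succ n ih =>
    obtain ⟨S, hS, h⟩ := ih
    refine ⟨insert 1 (Set.image2 (fun x s => t ^ (x.1 : ℤ) * of x.2 * s) T S),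
      (hT.image2 _ hS).insert 1, fun l hl hlT => ?_⟩
    cases l with
    | nil => simp
    | cons x l =>
      refine Set.mem_insert_of_mem _ ⟨x, hlT x (by simp), syllables φ l, ?_, by simp⟩
      exact h l (by simpa using hl) fun y hy => hlT y (by simp [hy])

end Edges

/-- The distance on the Bass–Serre tree as a left invariant kernel of negative type. Balls are
finite modulo the base group because the associated subgroups have finite index. -/
theorem exists_treeKernel (φ : A ≃* B) (hA : A.FiniteIndex) (hB : B.FiniteIndex) :
    ∃ N : HNNExtension G A B φ → HNNExtension G A B φ → ℝ, IsCondNeg N ∧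
      (∀ γ x y, N (γ * x) (γ * y) = N x y) ∧ (∀ g, N 1 (of g) = 0) ∧
      ∀ R : ℝ, ∃ S : Set (HNNExtension G A B φ), S.Finite ∧
        ∀ γ, N 1 γ ≤ R → ∃ g, ∃ s ∈ S, γ = of g * s := by
  let q : (Edge φ →₀ ℝ) → (Edge φ →₀ ℝ) → ℝ := fun x y => chainInner φ (x - y) (x - y)
  have hq : IsCondNeg q := by
    -- The squared norm is the sum over edges of squared coordinate differences, each of negative
    -- type.
    have h1 : ∀ x y : Edge φ →₀ ℝ, HasSum (fun e => (x e - y e) ^ 2) (q x y) := fun x y => by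
      simp only [q, chainInner_self]
      exact hasSum_sum_of_ne_finset_zero fun e he => by
        have : (x - y) e = 0 := by simpa using he
        rw [Finsupp.sub_apply] at this
        rw [this]; ring
    have h2 := IsCondNeg.tsum (N := fun (e : Edge φ) (x y : Edge φ →₀ ℝ) => (x e - y e) ^ 2)
      (fun e => IsCondNeg.sq_sub _) fun x y => (h1 x y).summable
    simpa only [(h1 _ _).tsum_eq] using h2
  have hN1 : ∀ γ, q (pathChain φ 1) (pathChain φ γ) =
      chainInner φ (pathChain φ γ) (pathChain φ γ) := fun γ => by simp [q]
  refine ⟨fun γ γ' => q (pathChain φ γ) (pathChain φ γ'), hq.comp _, fun γ x y => ?_, fun g => ?_,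
    fun R => ?_⟩
  · simp only [q, pathChain_mul, add_sub_add_left_eq_sub, ← map_sub, chainInner_chainRep]
  · simp [q]
  -- In the normal form, all base elements except the head lie in transversals, finite by the index
  -- hypotheses, and the number of syllables is at most the kernel value.
  · obtain ⟨d⟩ := NormalWord.TransversalPair.nonempty G A B
    have hfin : ∀ u, (d.set u).Finite := fun u => by
      have : (toSubgroup A B u).FiniteIndex := by
        rcases Int.units_eq_one_or u with rfl | rfl
        · exact hA
        · exact hB
      exact (d.compl u).finite_right
    obtain ⟨S, hS, h⟩ := exists_finite_syllables φ {x : ℤˣ × G | x.2 ∈ d.set x.1} (by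
      refine (Set.finite_iUnion fun u => (hfin u).image (Prod.mk u)).subset ?_
      rintro ⟨u, g⟩ hx
      exact Set.mem_iUnion.2 ⟨u, g, hx, rfl⟩) ⌊R⌋₊
    refine ⟨S, hS, fun γ hγ => ?_⟩
    replace hγ := (hN1 γ).symm.trans_le hγ
    obtain ⟨w, rfl⟩ := (NormalWord.equiv φ d).symm.surjective γ
    have hw : (NormalWord.equiv φ d).symm w = of w.head * syllables φ w.toList := rfl
    refine ⟨w.head, _, h w.toList ?_ fun x hx => w.mem_set _ _ hx, hw⟩
    rw [hw, pathChain_mul, pathChain_of, zero_add, chainInner_chainRep] at hγ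
    exact Nat.le_floor ((length_le_chainInner φ _ w.chain).trans hγ)

end HNNExtension

/-! ### The invariant kernel on the suspension. -/

/-- The tent function of height one and width `2 ^ j`. -/
noncomputable def tent (j : ℕ) (i : ℤ) : ℝ := max 0 (1 - |(i : ℝ)| / 2 ^ j)

theorem tent_nonneg (j : ℕ) (i : ℤ) : 0 ≤ tent j i := le_max_left _ _

theorem tent_le_one (j : ℕ) (i : ℤ) : tent j i ≤ 1 :=
  max_le zero_le_one (sub_le_self _ (by positivity))

theorem tent_zero (j : ℕ) : tent j 0 = 1 := by simp [tent]

theorem tent_eq_zero {j : ℕ} {i : ℤ} (h : 2 ^ j ≤ |(i : ℝ)|) : tent j i = 0 := by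
  have : 1 ≤ |(i : ℝ)| / 2 ^ j := (one_le_div (by positivity)).2 h
  exact max_eq_left (by linarith)

theorem tent_sub_sq_le (j : ℕ) (i i' : ℤ) :
    (tent j i - tent j i') ^ 2 ≤ ((i : ℝ) - i') ^ 2 * (1 / 4) ^ j := by
  have h1 : |tent j i - tent j i'| ≤ |(i : ℝ) - i'| / 2 ^ j := by
    refine (abs_max_sub_max_le_max _ _ _ _).trans ?_
    rw [sub_self, abs_zero, max_eq_right (abs_nonneg _)]
    have e : 1 - |(i : ℝ)| / 2 ^ j - (1 - |(i' : ℝ)| / 2 ^ j) = (|(i' : ℝ)| - |(i : ℝ)|) / 2 ^ j := by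
      ring
    rw [e, abs_div, abs_of_pos (by positivity : (0 : ℝ) < 2 ^ j), abs_sub_comm (i : ℝ)]
    exact div_le_div_of_nonneg_right (abs_abs_sub_abs_le _ _) (by positivity)
  calc (tent j i - tent j i') ^ 2 = |tent j i - tent j i'| ^ 2 := (sq_abs _).symm
    _ ≤ (|(i : ℝ) - i'| / 2 ^ j) ^ 2 := by gcongr
    _ = ((i : ℝ) - i') ^ 2 * (1 / 4) ^ j := by
      rw [div_pow, sq_abs, ← pow_mul, mul_comm j 2, pow_mul, one_div, inv_pow]
      norm_num [div_eq_mul_inv]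

/-- A summable weight on `ℕ × ℤ` supported on a neighbourhood of the supports of the tents. -/
noncomputable def tentWeight (m : ℕ) (p : ℕ × ℤ) : ℝ :=
  if |(p.2 : ℝ)| ≤ 2 ^ p.1 + 2 ^ m then (1 / 4) ^ p.1 else 0

theorem summable_tentWeight (m : ℕ) : Summable (tentWeight m) := by
  have hsupp : ∀ j : ℕ, ∀ i ∉ Finset.Icc (-(2 ^ j + 2 ^ m : ℤ)) (2 ^ j + 2 ^ m),
      tentWeight m (j, i) = 0 := by
    intro j i hi
    rw [tentWeight, if_neg]
    intro h
    apply hi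
    have h' : |i| ≤ 2 ^ j + 2 ^ m := by exact_mod_cast h
    exact Finset.mem_Icc.2 (abs_le.1 h')
  refine (summable_prod_of_nonneg fun p => ?_).2
    ⟨fun j => summable_of_ne_finset_zero (hsupp j), ?_⟩
  · simp only [tentWeight, Pi.zero_apply]; positivity
  -- For fixed `j` there are about 2·2^j + 2·2^m indices of weight 4^(-j), so the row sums are
  -- O(2^(-j)).
  · refine Summable.of_nonneg_of_le (fun j => tsum_nonneg fun i => ?_) (fun j => ?_)
      ((summable_geometric_of_lt_one (r := 1 / 2) (by norm_num) (by norm_num)).mul_left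
        (2 * 2 ^ m + 3))
    · simp only [tentWeight]; positivity
    · rw [tsum_eq_sum (hsupp j)]
      have h1 : ∀ i ∈ Finset.Icc (-(2 ^ j + 2 ^ m : ℤ)) (2 ^ j + 2 ^ m),
          tentWeight m (j, i) ≤ (1 / 4) ^ j := fun i _ => by
        simp only [tentWeight]; split_ifs
        · exact le_rfl
        · positivity
      refine (Finset.sum_le_card_nsmul _ _ _ h1).trans ?_
      have hc : ((Finset.Icc (-(2 ^ j + 2 ^ m : ℤ)) (2 ^ j + 2 ^ m)).card : ℝ) =
          2 * (2 ^ j + 2 ^ m) + 1 := by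
        rw [Int.card_Icc]
        have : (2 ^ j + 2 ^ m + 1 - -(2 ^ j + 2 ^ m) : ℤ).toNat = 2 * (2 ^ j + 2 ^ m) + 1 := by
          have : (2 ^ j + 2 ^ m + 1 - -(2 ^ j + 2 ^ m) : ℤ) =
            ((2 * (2 ^ j + 2 ^ m) + 1 : ℕ) : ℤ) := by push_cast; ring
          rw [this, Int.toNat_natCast]
        rw [this]; push_cast; ring
      rw [nsmul_eq_mul, hc]
      have h2 : (1 / 4 : ℝ) ^ j = (1 / 2) ^ j * (1 / 2) ^ j := by
        rw [← mul_pow]; norm_num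
      have h3 : (1 / 2 : ℝ) ^ j * 2 ^ j = 1 := by rw [← mul_pow]; norm_num
      have h4 : (1 / 2 : ℝ) ^ j ≤ 1 := pow_le_one₀ (by norm_num) (by norm_num)
      have h5 : (0 : ℝ) < (1 / 2) ^ j := by positivity
      have h6 : (0 : ℝ) < 2 ^ m := by positivity
      have h7 : (2 * (2 ^ j + 2 ^ m) + 1) * (1 / 2 : ℝ) ^ j ≤ 2 * 2 ^ m + 3 := by
        nlinarith
      rw [h2, ← mul_assoc]
      exact mul_le_mul_of_nonneg_right h7 h5.le

theorem continuous_mulAut_zpow {𝔑 : Type*} [Group 𝔑] [TopologicalSpace 𝔑] (φ : 𝔑 ≃ₜ* 𝔑) (i : ℤ) :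
    Continuous ⇑((φ.toMulEquiv : MulAut 𝔑) ^ i) := by
  induction i using Int.induction_on with
  | zero => simpa using continuous_id
  | succ i h =>
    rw [zpow_add_one, MulAut.coe_mul]
    exact h.comp φ.continuous
  | pred i h =>
    rw [zpow_sub_one, MulAut.coe_mul]
    exact h.comp φ.symm.continuous

section Suspension

open Topology

variable {𝔑 V : Type u} [Group 𝔑] [NormedAddCommGroup V]
  [InnerProductSpace ℝ V] (α : 𝔑 →* (V ≃ᵃⁱ[ℝ] V)) (f : MulAut 𝔑)

theorem dist_orbit_mul_left (g n n' : 𝔑) :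
    dist (α (g * n) 0) (α (g * n') 0) = dist (α n 0) (α n' 0) := by
  rw [map_mul, map_mul]
  exact (α g).dist_map _ _

theorem dist_orbit_eq (n n' : 𝔑) : dist (α n 0) (α n' 0) = dist 0 (α (n⁻¹ * n') 0) := by
  rw [← dist_orbit_mul_left α n⁻¹, inv_mul_cancel, map_one]
  rfl

/-- The Gaussian kernels on `𝔑 × ℤ` twisted by the powers of an automorphism and cut off by
tents. -/
noncomputable def tentKernel (s : ℕ → ℝ) (p : ℕ × ℤ) (x y : 𝔑 × ℤ) : ℝ :=
  tent p.1 (p.2 + x.2) * tent p.1 (p.2 + y.2) *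
    Real.exp (-s p.1 * dist (α ((f ^ p.2) x.1) 0) (α ((f ^ p.2) y.1) 0) ^ 2)

/-- The squared distance associated with `tentKernel`. -/
noncomputable def tentDist (s : ℕ → ℝ) (p : ℕ × ℤ) (x y : 𝔑 × ℤ) : ℝ :=
  tentKernel α f s p x x + tentKernel α f s p y y - 2 * tentKernel α f s p x y

theorem isCondNeg_tentDist {s : ℕ → ℝ} (hs : ∀ j, 0 ≤ s j) (p : ℕ × ℤ) :
    IsCondNeg (tentDist α f s p) :=
  IsPosKernel.isCondNeg
    ((IsPosKernel.exp_neg_dist_sq (fun x : 𝔑 × ℤ => α ((f ^ p.2) x.1) 0) (hs p.1)).mul_left_right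
      fun x => tent p.1 (p.2 + x.2))
    fun x y => by simp only [tentKernel]; rw [dist_comm]; ring

/-- The first coordinates enter only through `x.1⁻¹ * y.1`, which gives left invariance; the two
summands, from the tents and from the Gaussian, are estimated separately. -/
theorem tentDist_eq (s : ℕ → ℝ) (p : ℕ × ℤ) (x y : 𝔑 × ℤ) :
    tentDist α f s p x y = (tent p.1 (p.2 + x.2) - tent p.1 (p.2 + y.2)) ^ 2 +
      2 * (tent p.1 (p.2 + x.2) * tent p.1 (p.2 + y.2)) *
        (1 - Real.exp (-s p.1 * dist 0 (α ((f ^ p.2) (x.1⁻¹ * y.1)) 0) ^ 2)) := by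
  simp only [tentDist, tentKernel, dist_self]
  rw [dist_orbit_eq, map_mul, map_inv]
  simp
  ring

theorem tentDist_mul_left (s : ℕ → ℝ) (p : ℕ × ℤ) (g : 𝔑) (x y : 𝔑 × ℤ) :
    tentDist α f s p (g * x.1, x.2) (g * y.1, y.2) = tentDist α f s p x y := by
  simp only [tentDist_eq]
  congr 7
  group

/-- The suspension map only reindexes `i`, so it disappears after summation over ℤ. -/
theorem tentDist_shift (s : ℕ → ℝ) (j : ℕ) (i : ℤ) (x y : 𝔑 × ℤ) :
    tentDist α f s (j, i) (f x.1, x.2 + 1) (f y.1, y.2 + 1) = tentDist α f s (j, i + 1) x y := by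
  simp only [tentDist, tentKernel, zpow_add_one, MulAut.mul_apply]
  simp only [add_assoc, add_comm (1 : ℤ)]

/-- Outside |i| ≤ 2^j + 2^m both tents vanish. Inside, the tent part is at most the squared shift
times 4^(-j). The Gaussian part is trivial for j < m; for j ≥ m one has |i| ≤ 2·2^j, exactly the
range in which `s j` is controlled. -/
theorem tentDist_le {s : ℕ → ℝ} {K : ℕ → Set 𝔑} (hK : Monotone K) (hs0 : ∀ j, 0 ≤ s j)
    (hs : ∀ j, ∀ i : ℤ, |(i : ℝ)| ≤ 2 * 2 ^ j → ∀ g ∈ K j,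
      s j * dist 0 (α ((f ^ i) g) 0) ^ 2 ≤ (1 / 4) ^ j)
    {m : ℕ} {x y : 𝔑 × ℤ} (hx : |(x.2 : ℝ)| ≤ 2 ^ m) (hy : |(y.2 : ℝ)| ≤ 2 ^ m)
    (hm : x.1⁻¹ * y.1 ∈ K m) (p : ℕ × ℤ) :
    tentDist α f s p x y ≤ (((x.2 : ℝ) - y.2) ^ 2 + 2 * 4 ^ m) * tentWeight m p := by
  obtain ⟨j, i⟩ := p
  rw [tentDist_eq]
  dsimp only
  set E := Real.exp (-s j * dist 0 (α ((f ^ i) (x.1⁻¹ * y.1)) 0) ^ 2) with hE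
  have hE0 : 0 < E := Real.exp_pos _
  have h1E : 0 ≤ 1 - E := by
    rw [hE, sub_nonneg, Real.exp_le_one_iff]
    nlinarith [hs0 j, sq_nonneg (dist 0 (α ((f ^ i) (x.1⁻¹ * y.1)) 0))]
  by_cases hi : |(i : ℝ)| ≤ 2 ^ j + 2 ^ m
  · rw [tentWeight, if_pos hi, add_mul]
    refine add_le_add ?_ ?_
    · have := tent_sub_sq_le j (i + x.2) (i + y.2)
      push_cast at this
      simpa using this
    · have h2 : 1 - E ≤ 4 ^ m * (1 / 4) ^ j := by
        rcases lt_or_ge j m with hjm | hjm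
        · have : (1 : ℝ) ≤ 4 ^ m * (1 / 4) ^ j := by
            rw [one_div, inv_pow, ← div_eq_mul_inv, one_le_div (by positivity)]
            exact pow_le_pow_right₀ (by norm_num) hjm.le
          linarith
        · have h3 := hs j i (hi.trans (by
            rw [two_mul]; gcongr; norm_num)) _ (hK hjm hm)
          have h4 := Real.add_one_le_exp (-s j * dist 0 (α ((f ^ i) (x.1⁻¹ * y.1)) 0) ^ 2)
          have h5 : (1 : ℝ) ≤ 4 ^ m := one_le_pow₀ (by norm_num)
          have h6 : (0 : ℝ) < (1 / 4) ^ j := by positivity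
          nlinarith
      have h7 : tent j (i + x.2) * tent j (i + y.2) ≤ 1 :=
        mul_le_one₀ (tent_le_one _ _) (tent_nonneg _ _) (tent_le_one _ _)
      have h8 : tent j (i + x.2) * tent j (i + y.2) * (1 - E) ≤ 1 * (1 - E) :=
        mul_le_mul_of_nonneg_right h7 h1E
      linarith
  · have hz : ∀ k : ℤ, |(k : ℝ)| ≤ 2 ^ m → tent j (i + k) = 0 := fun k hk => by
      apply tent_eq_zero
      push_cast
      have := abs_sub_abs_le_abs_sub (i : ℝ) (-k)
      rw [abs_neg, sub_neg_eq_add] at this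
      linarith [not_le.1 hi]
    rw [hz _ hx, hz _ hy, tentWeight, if_neg hi]
    simp

/-- A proper affine isometric action of `𝔑` and an automorphism `φ` of `𝔑` give a kernel of
negative type on `𝔑 × ℤ` that is invariant under the left action of `𝔑 ⋊ ℤ` and still proper
on `𝔑`. -/
theorem exists_suspensionKernel [TopologicalSpace 𝔑] [IsTopologicalGroup 𝔑] [T2Space 𝔑]
    [LocallyCompactSpace 𝔑] [SigmaCompactSpace 𝔑] (hα : IsMetricallyProperAction α) (φ : 𝔑 ≃ₜ* 𝔑) :
    ∃ N : 𝔑 × ℤ → 𝔑 × ℤ → ℝ, IsCondNeg N ∧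
      (∀ g x y, N (g * x.1, x.2) (g * y.1, y.2) = N x y) ∧
      (∀ x y, N (φ x.1, x.2 + 1) (φ y.1, y.2 + 1) = N x y) ∧
      ContinuousAt (fun g => N (1, 0) (g, 0)) 1 ∧
      ∀ R : ℝ, ∃ K : Set 𝔑, IsCompact K ∧ ∀ g, N (1, 0) (g, 0) ≤ R → g ∈ K := by
  let f : MulAut 𝔑 := φ.toMulEquiv
  have hf : ∀ i : ℤ, Continuous ⇑(f ^ i) := continuous_mulAut_zpow φ
  let K : CompactExhaustion 𝔑 := default
  have hKmono : Monotone fun j => K j := fun _ _ h => K.subset h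
  have hψ : ∀ i : ℤ, Continuous fun g => dist 0 (α ((f ^ i) g) 0) ^ 2 := fun i =>
    (continuous_const.dist ((hα 0).1.comp (hf i))).pow 2
  have hs : ∀ j : ℕ, ∃ s : ℝ, 0 < s ∧ ∀ i : ℤ, |(i : ℝ)| ≤ 2 * 2 ^ j → ∀ g ∈ K j,
      s * dist 0 (α ((f ^ i) g) 0) ^ 2 ≤ (1 / 4) ^ j := by
    intro j
    let F : 𝔑 → ℝ := fun g => ∑ i ∈ Finset.Icc (-(2 * 2 ^ j) : ℤ) (2 * 2 ^ j),
      dist 0 (α ((f ^ i) g) 0) ^ 2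
    have hF : Continuous F := continuous_finsetSum _ fun i _ => hψ i
    obtain ⟨C, hC⟩ := (K.isCompact j).exists_bound_of_continuousOn hF.continuousOn
    -- `C` bounds the finitely many relevant twists simultaneously on the compact set `K j`.
    refine ⟨(1 / 4) ^ j / (|C| + 1), by positivity, fun i hi g hg => ?_⟩
    have h1 : dist 0 (α ((f ^ i) g) 0) ^ 2 ≤ F g := by
      refine Finset.single_le_sum (f := fun i => dist 0 (α ((f ^ i) g) 0) ^ 2)
        (fun i _ => sq_nonneg _) (Finset.mem_Icc.2 (abs_le.1 ?_))
      exact_mod_cast hi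
    have h2 : F g ≤ |C| + 1 := by
      linarith [le_abs_self (F g), hC g hg, Real.norm_eq_abs (F g), le_abs_self C]
    rw [div_mul_eq_mul_div, div_le_iff₀ (by positivity)]
    exact mul_le_mul_of_nonneg_left (h1.trans h2) (by positivity)
  choose s hs0 hs using hs
  have hle := @tentDist_le 𝔑 V _ _ _ α f s (fun j => K j) hKmono (fun j => (hs0 j).le) hs
  have hcn : ∀ p, IsCondNeg (tentDist α f s p) := isCondNeg_tentDist α f fun j => (hs0 j).le
  have hsum : ∀ x y, Summable fun p => tentDist α f s p x y := by
    intro x y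
    obtain ⟨m₁, hm₁⟩ := pow_unbounded_of_one_lt |(x.2 : ℝ)| (one_lt_two : (1 : ℝ) < 2)
    obtain ⟨m₂, hm₂⟩ := pow_unbounded_of_one_lt |(y.2 : ℝ)| (one_lt_two : (1 : ℝ) < 2)
    obtain ⟨m₃, hm₃⟩ := K.exists_mem (x.1⁻¹ * y.1)
    let m := m₁ + m₂ + m₃
    have hpow : ∀ k, k ≤ m → (2 : ℝ) ^ k ≤ 2 ^ m := fun k hk =>
      pow_le_pow_right₀ one_le_two hk
    refine Summable.of_nonneg_of_le (fun p => (hcn p).nonneg x y)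
      (hle (m := m) (hm₁.le.trans (hpow _ (by omega))) (hm₂.le.trans (hpow _ (by omega)))
        (hKmono (by omega : m₃ ≤ m) hm₃))
      ((summable_tentWeight m).mul_left _)
  have hterm : ∀ p g, tentDist α f s p (1, 0) (g, 0) = 2 * (tent p.1 p.2 * tent p.1 p.2) *
      (1 - Real.exp (-s p.1 * dist 0 (α ((f ^ p.2) g) 0) ^ 2)) := fun p g => by
    rw [tentDist_eq]; simp
  refine ⟨fun x y => ∑' p, tentDist α f s p x y, IsCondNeg.tsum hcn hsum, fun g x y => ?_,
    fun x y => ?_, ?_, fun R => ?_⟩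
  · simp only [tentDist_mul_left]
  · change ∑' p, tentDist α f s p _ _ = ∑' p, tentDist α f s p x y
    rw [← ((Equiv.refl ℕ).prodCongr (Equiv.addRight (1 : ℤ))).tsum_eq
      fun p => tentDist α f s p x y]
    exact tsum_congr fun p => tentDist_shift α f s p.1 p.2 x y
  · obtain ⟨m, hm⟩ := K.exists_mem (1 : 𝔑)
    have hU : interior (K (m + 1)) ∈ 𝓝 (1 : 𝔑) :=
      isOpen_interior.mem_nhds (K.subset_interior_succ m hm)
    refine ContinuousOn.continuousAt (continuousOn_tsum (fun p => Continuous.continuousOn ?_)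
      ((summable_tentWeight (m + 1)).mul_left (2 * 4 ^ (m + 1))) fun p g hg => ?_) hU
    · simp only [hterm]
      exact continuous_const.mul (continuous_const.sub
        (Real.continuous_exp.comp (continuous_const.mul (hψ _))))
    · rw [Real.norm_of_nonneg ((hcn p).nonneg _ _)]
      have := hle (m := m + 1) (x := (1, 0)) (y := (g, 0)) (by simp) (by simp)
        (by simpa using interior_subset hg) p
      simpa using this
  -- Beyond squared displacement 1/σ, each of the `M` terms `(j, 0)` with `j < M` is at least 2(1 -
  -- 1/2) = 1, so the sum exceeds `R`.
  · obtain ⟨M, hM⟩ := exists_nat_gt R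
    obtain ⟨σ, hσ0, hσ⟩ : ∃ σ : ℝ, 0 < σ ∧ ∀ j < M, σ ≤ s j := by
      clear hM
      induction M with
      | zero => exact ⟨1, one_pos, by simp⟩
      | succ M ih =>
        obtain ⟨σ, h0, h⟩ := ih
        refine ⟨min σ (s M), lt_min h0 (hs0 M), fun j hj => ?_⟩
        rcases Nat.lt_succ_iff_lt_or_eq.1 hj with hj | rfl
        · exact (min_le_left _ _).trans (h j hj)
        · exact min_le_right _ _
    refine ⟨(fun g => dist 0 (α g 0)) ⁻¹' Set.Icc 0 (√(1 / σ)),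
      (hα 0).2.isCompact_preimage isCompact_Icc, fun g hg => ⟨dist_nonneg, ?_⟩⟩
    by_contra hlt
    have hlt' : 1 / σ < dist 0 (α g 0) ^ 2 := (Real.sqrt_lt' (by
      exact (Real.sqrt_nonneg _).trans_lt (not_le.1 hlt))).1 (not_le.1 hlt)
    have h1 : ∀ j < M, 1 ≤ tentDist α f s (j, 0) (1, 0) (g, 0) := fun j hj => by
      rw [hterm]
      simp only [tent_zero, zpow_zero, MulAut.one_apply]
      have h2 : 1 ≤ s j * dist 0 (α g 0) ^ 2 := by
        rw [div_lt_iff₀ hσ0] at hlt'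
        nlinarith [hσ j hj, sq_nonneg (dist 0 (α g 0))]
      have h3 : Real.exp (-s j * dist 0 (α g 0) ^ 2) ≤ 1 / 2 := by
        rw [neg_mul, Real.exp_neg, one_div]
        refine inv_anti₀ two_pos ?_
        linarith [Real.add_one_le_exp (s j * dist 0 (α g 0) ^ 2)]
      linarith
    have h2 : (M : ℝ) ≤ ∑ p ∈ (Finset.range M).image fun j => (j, (0 : ℤ)),
        tentDist α f s p (1, 0) (g, 0) := by
      rw [Finset.sum_image fun a _ b _ h => (Prod.mk.inj h).1]
      have := Finset.card_nsmul_le_sum (Finset.range M)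
        (fun j => tentDist α f s (j, 0) (1, 0) (g, 0)) 1 fun j hj => h1 j (Finset.mem_range.1 hj)
      simpa using this
    have h3 := (hsum (1, 0) (g, 0)).sum_le_tsum
      ((Finset.range M).image fun j => (j, (0 : ℤ))) fun p _ => (hcn p).nonneg _ _
    linarith

end Suspension

/-! ### Combining the two kernels on the HNN extension. -/

namespace HNNExtension

open Topology

section SuspensionAction

variable {𝔑 G : Type*} [Group 𝔑] [Group G] {A B : Subgroup G} {φ : A ≃* B}

/-- The action of an HNN extension on `𝔑 × ℤ` for which the base group acts by left translations
through a homomorphism to `𝔑` and the stable letter by an automorphism of `𝔑` and a shift. -/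
def suspensionAction (ι : G →* 𝔑) (Φ : 𝔑 ≃* 𝔑) (hΦ : ∀ a : A, Φ (ι a) = ι (φ a)) :
    HNNExtension G A B φ →* Equiv.Perm (𝔑 × ℤ) :=
  lift
    { toFun := fun g => (Equiv.mulLeft (ι g)).prodCongr (Equiv.refl ℤ)
      map_one' := by ext x <;> simp
      map_mul' := fun g g' => by ext x <;> simp [mul_assoc] }
    (Φ.toEquiv.prodCongr (Equiv.addRight 1))
    (fun a => by ext x <;> simp [hΦ])

variable {ι : G →* 𝔑} {Φ : 𝔑 ≃* 𝔑} (hΦ : ∀ a : A, Φ (ι a) = ι (φ a))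

theorem suspensionAction_of (g : G) (x : 𝔑 × ℤ) :
    suspensionAction ι Φ hΦ (of g) x = (ι g * x.1, x.2) := by
  simp [suspensionAction, Prod.map]

theorem suspensionAction_t (x : 𝔑 × ℤ) :
    suspensionAction ι Φ hΦ t x = (Φ x.1, x.2 + 1) := by
  simp [suspensionAction, Prod.map]

theorem suspensionAction_invariant {N : 𝔑 × ℤ → 𝔑 × ℤ → ℝ}
    (h1 : ∀ g x y, N (g * x.1, x.2) (g * y.1, y.2) = N x y)
    (h2 : ∀ x y, N (Φ x.1, x.2 + 1) (Φ y.1, y.2 + 1) = N x y) (γ : HNNExtension G A B φ)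
    (x y : 𝔑 × ℤ) :
    N (suspensionAction ι Φ hΦ γ x) (suspensionAction ι Φ hΦ γ y) = N x y := by
  induction γ using induction_on generalizing x y with
  | of g => rw [suspensionAction_of, suspensionAction_of, h1]
  | t => rw [suspensionAction_t, suspensionAction_t, h2]
  | mul γ γ' h h' => rw [map_mul, Equiv.Perm.mul_apply, Equiv.Perm.mul_apply, h, h']
  | inv γ h =>
    have e : ∀ z, suspensionAction ι Φ hΦ γ (suspensionAction ι Φ hΦ γ⁻¹ z) = z := fun z => by
      rw [map_inv]; exact Equiv.apply_symm_apply _ z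
    rw [← h, e, e]

end SuspensionAction

/-- An HNN extension of a closed subgroup `G` of an a-T-menable group `𝔑`, along finite index open
subgroups conjugated by an automorphism of `𝔑`, is a-T-menable. -/
theorem isATMenable {𝔑 G : Type u} [Group 𝔑] [TopologicalSpace 𝔑] (h𝔑 : IsATMenable 𝔑)
    [Group G] [TopologicalSpace G] [IsTopologicalGroup G] {A B : Subgroup G} {φ : A ≃* B}
    (hA : IsOpen (A : Set G)) (hB : IsOpen (B : Set G)) (hφ : Continuous φ)
    (hφ' : Continuous φ.symm) (hAfin : A.FiniteIndex) (hBfin : B.FiniteIndex) (ι : G →* 𝔑)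
    (hι : IsClosedEmbedding ι) (Φ : 𝔑 ≃ₜ* 𝔑) (hΦ : ∀ a : A, Φ (ι a) = ι (φ a)) :
    IsATMenable (HNNExtension G A B φ) := by
  obtain ⟨_, _, _, _, W, _, _, _, α₀, hα₀⟩ := h𝔑
  have hof := isOpenEmbedding_of hA hB hφ hφ'
  have : T2Space G := hι.isEmbedding.t2Space
  have : LocallyCompactSpace G := hι.locallyCompactSpace
  have : SecondCountableTopology G := hι.isEmbedding.secondCountableTopology
  have hT2 : T2Space (HNNExtension G A B φ) := t2Space_of_isOpenEmbedding_monoidHom of hof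
  have hLC : LocallyCompactSpace (HNNExtension G A B φ) :=
    locallyCompactSpace_of_isOpenEmbedding_monoidHom of hof
  obtain ⟨N₂, hN₂, hinv₂, hof₂, hball⟩ := exists_treeKernel φ hAfin hBfin
  have hSC : SecondCountableTopology (HNNExtension G A B φ) := by
    choose S hS hcover using fun n : ℕ => hball n
    refine secondCountableTopology_of_isOpenEmbedding_monoidHom of hof (⋃ n, S n)
      (Set.countable_iUnion fun n => (hS n).countable) fun γ => ?_
    obtain ⟨n, hn⟩ := exists_nat_ge (N₂ 1 γ)
    obtain ⟨g, s, hs, h⟩ := hcover n γ hn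
    exact ⟨g, s, Set.mem_iUnion.2 ⟨n, hs⟩, h⟩
  obtain ⟨N₁, hN₁, hl, hshift, hcont, hproper⟩ := exists_suspensionKernel α₀ hα₀ Φ
  let P := suspensionAction ι Φ.toMulEquiv hΦ
  have hP : ∀ g, P (of g) (1, 0) = (ι g, 0) := fun g => by
    simp [P, suspensionAction_of]
  let N : HNNExtension G A B φ → HNNExtension G A B φ → ℝ :=
    fun γ γ' => N₁ (P γ (1, 0)) (P γ' (1, 0)) + N₂ γ γ'
  have hN : IsCondNeg N := (hN₁.comp _).add hN₂
  have hN_of : ∀ g, N 1 (of g) = N₁ (1, 0) (ι g, 0) := fun g => by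
    simp only [N, hof₂, add_zero, map_one, hP]
    rfl
  obtain ⟨V, i1, i2, i3, α, hαc, hα⟩ := hN.exists_action
    (fun γ x y => by
      simp only [N, hinv₂, map_mul, Equiv.Perm.mul_apply]
      rw [suspensionAction_invariant hΦ hl hshift])
    (by
      -- Continuity at 1 is local, so it is tested on the open subgroup `G`, where the tree kernel
      -- vanishes.
      rw [← map_one (of : G →* HNNExtension G A B φ), ← hof.continuousAt_iff, map_one]
      have : (fun γ => N 1 γ) ∘ of = (fun n => N₁ (1, 0) (n, 0)) ∘ ι := funext hN_of
      rw [this]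
      refine ContinuousAt.comp ?_ hι.continuous.continuousAt
      rwa [map_one])
  refine ⟨inferInstance, hT2, hLC, hSC, V, i1, i2, i3, α, fun x => ⟨hαc x, ?_⟩⟩
  rw [isProperMap_iff_isCompact_preimage]
  refine ⟨continuous_const.dist (hαc x), fun K hK => ?_⟩
  obtain ⟨R, hR⟩ := hK.bddAbove
  -- Displacements at `x` and at the origin differ by at most `2 * dist 0 x`, so properness at the
  -- origin suffices.
  have hR' : ∀ γ, dist x (α γ x) ∈ K → dist 0 (α γ 0) ≤ R + 2 * dist 0 x := fun γ hγ => by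
    have h1 : dist (α γ x) (α γ 0) = dist 0 x := by rw [(α γ).dist_map, dist_comm]
    linarith [dist_triangle4 0 x (α γ x) (α γ 0), hR hγ]
  set R' := R + 2 * dist 0 x
  obtain ⟨S, hS, hcover⟩ := hball (R' ^ 2)
  obtain ⟨D, hD⟩ := (hS.image fun s => dist 0 (α s 0)).bddAbove
  obtain ⟨C, hC, hC'⟩ := hproper ((R' + D) ^ 2)
  have hcomp : IsCompact (⋃ s ∈ S, (fun g => of g * s) '' (ι ⁻¹' C)) :=
    hS.isCompact_biUnion fun s _ =>
      (hι.isCompact_preimage hC).image (hof.continuous.mul continuous_const)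
  refine hcomp.of_isClosed_subset (hK.isClosed.preimage (continuous_const.dist (hαc x)))
    fun γ hγ => ?_
  have h1 := hR' γ hγ
  have h2 : N₂ 1 γ ≤ R' ^ 2 := by
    have h3 : N 1 γ ≤ R' ^ 2 := by
      rw [← hα]
      exact pow_le_pow_left₀ dist_nonneg h1 2
    have h4 := hN₁.nonneg (P 1 (1, 0)) (P γ (1, 0))
    simp only [N] at h3
    linarith
  obtain ⟨g, s, hs, rfl⟩ := hcover γ h2
  refine Set.mem_biUnion hs ⟨g, hC' (ι g) ?_, rfl⟩
  rw [← hN_of, ← hα]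
  refine pow_le_pow_left₀ dist_nonneg ?_ 2
  -- Removing `s` changes the displacement by at most `D`, the maximal displacement over the finite
  -- set `S`.
  have h5 : dist (α (of g * s) 0) (α (of g) 0) = dist 0 (α s 0) := by
    rw [map_mul]
    exact ((α (of g)).dist_map _ _).trans (dist_comm _ _)
  linarith [dist_triangle 0 (α (of g * s) 0) (α (of g) 0), hD ⟨s, hs, rfl⟩]

theorem isCompactlyGeneratedGroup {G : Type u} [Group G] [TopologicalSpace G] {A B : Subgroup G}
    {φ : A ≃* B} (hG : IsCompactlyGeneratedGroup G) :
    IsCompactlyGeneratedGroup (HNNExtension G A B φ) := by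
  obtain ⟨K, hK, hgen⟩ := hG
  refine ⟨insert t (of '' K), (hK.image continuous_of).insert t, ?_⟩
  refine (Subgroup.eq_top_iff' _).2 fun γ => ?_
  induction γ using induction_on with
  | of g =>
    have h1 : (Subgroup.closure K).map of ≤
        Subgroup.closure (insert t (of '' K) : Set (HNNExtension G A B φ)) := by
      rw [MonoidHom.map_closure]
      exact Subgroup.closure_mono (Set.subset_insert _ _)
    exact h1 ⟨g, by rw [hgen]; trivial, rfl⟩
  | t => exact Subgroup.subset_closure (Set.mem_insert _ _)
  | mul x y hx hy => exact mul_mem hx hy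
  | inv x hx => exact inv_mem hx

end HNNExtension

open Topology in
/-- The identification of two open images of a group is a homeomorphism. -/
theorem continuous_ofInjective_symm_trans {G H : Type*} [Group G] [TopologicalSpace G] [Group H]
    [TopologicalSpace H] {i₁ i₂ : H →* G} (h₁ : IsOpenEmbedding i₁) (h₂ : IsOpenEmbedding i₂) :
    Continuous ((MonoidHom.ofInjective h₁.injective).symm.trans
      (MonoidHom.ofInjective h₂.injective)) := by
  have h3 : Continuous (MonoidHom.ofInjective h₁.injective).symm := by
    rw [h₁.isInducing.continuous_iff]
    refine continuous_subtype_val.congr fun x => ?_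
    have := congrArg Subtype.val ((MonoidHom.ofInjective h₁.injective).apply_symm_apply x)
    exact this.symm
  have h4 : Continuous (MonoidHom.ofInjective h₂.injective) :=
    h₂.continuous.subtype_mk _
  exact h4.comp h3

open Topology in
theorem HNNOfInclusions.isATMenable {𝔑 G : Type u} {H : Type*} [Group 𝔑] [TopologicalSpace 𝔑]
    (h𝔑 : IsATMenable 𝔑) [Group G] [TopologicalSpace G] [IsTopologicalGroup G] [Group H]
    [TopologicalSpace H] {i₁ i₂ : H →* G} (h₁ : IsOpenEmbedding i₁) (h₂ : IsOpenEmbedding i₂)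
    (hf₁ : i₁.range.FiniteIndex) (hf₂ : i₂.range.FiniteIndex) (ι : G →* 𝔑)
    (hι : IsClosedEmbedding ι) (Φ : 𝔑 ≃ₜ* 𝔑) (hΦ : ∀ h, Φ (ι (i₁ h)) = ι (i₂ h)) :
    IsATMenable (HNNOfInclusions i₁ i₂ h₁.injective h₂.injective) := by
  refine HNNExtension.isATMenable h𝔑 (by simpa using h₁.isOpen_range)
    (by simpa using h₂.isOpen_range) (continuous_ofInjective_symm_trans h₁ h₂)
    (continuous_ofInjective_symm_trans h₂ h₁) hf₁ hf₂ ι hι Φ ?_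
  rintro ⟨_, h, rfl⟩
  have : (MonoidHom.ofInjective h₁.injective).symm ⟨i₁ h, h, rfl⟩ = h := by
    rw [MulEquiv.symm_apply_eq]; rfl
  rw [MulEquiv.trans_apply, this]
  exact hΦ h

/-! ### Baumslag–Solitar groups. -/

open Topology

/-- The additive group of the reals acts properly on the real line by translations. -/
theorem isATMenable_multiplicative_real : IsATMenable (Multiplicative ℝ) := by
  have h2 : SecondCountableTopology (Multiplicative ℝ) :=
    inferInstanceAs (SecondCountableTopology ℝ)
  have h3 : T2Space (Multiplicative ℝ) := inferInstanceAs (T2Space ℝ)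
  let α : Multiplicative ℝ →* (ℝ ≃ᵃⁱ[ℝ] ℝ) :=
    { toFun := fun v => AffineIsometryEquiv.constVAdd ℝ ℝ v.toAdd
      map_one' := by ext; simp
      map_mul' := fun v w => by ext; simp [add_assoc] }
  refine ⟨inferInstance, h3, inferInstance, h2, ℝ, inferInstance, inferInstance, inferInstance,
    α, fun x => ?_⟩
  have hα : ∀ v, α v x = v.toAdd + x := fun v => rfl
  simp only [hα]
  have hc : Continuous fun v : Multiplicative ℝ => v.toAdd + x :=
    continuous_toAdd.add continuous_const
  refine ⟨hc, (isProperMap_iff_isCompact_preimage).2 ⟨continuous_const.dist hc, fun K hK => ?_⟩⟩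
  obtain ⟨R, hR⟩ := hK.bddAbove
  have hball : IsCompact (Multiplicative.toAdd ⁻¹' Metric.closedBall (0 : ℝ) R) :=
    isCompact_closedBall (0 : ℝ) R
  refine hball.of_isClosed_subset (hK.isClosed.preimage (continuous_const.dist hc))
    fun v hv => ?_
  have := hR hv
  simpa [dist_eq_norm] using this

theorem zpowGroupHom_injective_multiplicative_int {m : ℤ} (hm : m ≠ 0) :
    Function.Injective (zpowGroupHom m : Multiplicative ℤ →* Multiplicative ℤ) := by
  intro x y h
  have h' : m * x.toAdd = m * y.toAdd := by
    simpa using congrArg Multiplicative.toAdd h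
  exact Multiplicative.toAdd.injective (mul_left_cancel₀ hm h')

theorem finiteIndex_range_zpowGroupHom_multiplicative_int {m : ℤ} (hm : m ≠ 0) :
    (zpowGroupHom m : Multiplicative ℤ →* Multiplicative ℤ).range.FiniteIndex := by
  have h := Subgroup.finiteIndex_range_powMonoidHom_of_fg (Multiplicative ℤ)
    (Int.natAbs_ne_zero.2 hm)
  refine Subgroup.finiteIndex_of_le (H := (powMonoidHom m.natAbs).range) ?_
  rintro _ ⟨x, rfl⟩
  obtain ⟨k, rfl | rfl⟩ := m.eq_nat_or_neg
  · exact ⟨x, by simp⟩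
  · exact ⟨x⁻¹, by simp⟩

/-- Multiplication by a nonzero real number as an automorphism of the additive group of the
reals. -/
noncomputable def realScaling (c : ℝ) (hc : c ≠ 0) : Multiplicative ℝ ≃ₜ* Multiplicative ℝ where
  toFun x := Multiplicative.ofAdd (c * x.toAdd)
  invFun x := Multiplicative.ofAdd (c⁻¹ * x.toAdd)
  left_inv x := by simp [hc]
  right_inv x := by simp [hc]
  map_mul' x y := by simp [mul_add]
  continuous_toFun := continuous_ofAdd.comp (continuous_const.mul continuous_toAdd)
  continuous_invFun := continuous_ofAdd.comp (continuous_const.mul continuous_toAdd)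

namespace BaumslagSolitar

variable (m n : ℤ)

/-- The generator of the base group. -/
def x : BaumslagSolitar m n := PresentedGroup.of false

/-- The stable letter. -/
def t : BaumslagSolitar m n := PresentedGroup.of true

theorem relation : t m n * x m n ^ m * (t m n)⁻¹ = x m n ^ n := by
  have h := PresentedGroup.one_of_mem (rels := ({FreeGroup.of true * FreeGroup.of false ^ m *
    (FreeGroup.of true)⁻¹ * (FreeGroup.of false ^ n)⁻¹} : Set (FreeGroup Bool)))
    (Set.mem_singleton _)
  simp only [map_mul, map_inv, map_zpow] at h
  exact mul_inv_eq_one.1 h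

theorem closure_generators : Subgroup.closure {x m n, t m n} = ⊤ := by
  have h := PresentedGroup.closure_range_of ({FreeGroup.of true * FreeGroup.of false ^ m *
    (FreeGroup.of true)⁻¹ * (FreeGroup.of false ^ n)⁻¹} : Set (FreeGroup Bool))
  refine top_le_iff.1 (h.ge.trans ((Subgroup.closure_le _).2 ?_))
  rintro _ ⟨b, rfl⟩
  cases b
  · exact Subgroup.subset_closure (Or.inl rfl)
  · exact Subgroup.subset_closure (Or.inr rfl)

variable {m n}

/-- The Baumslag–Solitar group as an HNN extension of the integers. -/
abbrev HNN (hm : m ≠ 0) (hn : n ≠ 0) : Type :=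
  HNNOfInclusions (zpowGroupHom m : Multiplicative ℤ →* Multiplicative ℤ)
    (zpowGroupHom n : Multiplicative ℤ →* Multiplicative ℤ)
    (zpowGroupHom_injective_multiplicative_int hm) (zpowGroupHom_injective_multiplicative_int hn)

variable (hm : m ≠ 0) (hn : n ≠ 0)

theorem ofInjective_zpow_apply (z : Multiplicative ℤ) :
    ((MonoidHom.ofInjective (zpowGroupHom_injective_multiplicative_int hm)).symm.trans
      (MonoidHom.ofInjective (zpowGroupHom_injective_multiplicative_int hn))
      ⟨z ^ m, z, rfl⟩ : Multiplicative ℤ) = z ^ n := by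
  have : (MonoidHom.ofInjective (zpowGroupHom_injective_multiplicative_int hm)).symm
      ⟨z ^ m, z, rfl⟩ = z := by
    rw [MulEquiv.symm_apply_eq]; rfl
  rw [MulEquiv.trans_apply, this]
  rfl

/-- The canonical homomorphism to the HNN extension. -/
noncomputable def toHNN : BaumslagSolitar m n →* HNN hm hn :=
  PresentedGroup.toGroup
    (f := fun b => if b then HNNExtension.t else HNNExtension.of (Multiplicative.ofAdd 1)) (by
      rintro _ rfl
      have h := HNNExtension.equiv_eq_conj
        (φ := (MonoidHom.ofInjective (zpowGroupHom_injective_multiplicative_int hm)).symm.trans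
          (MonoidHom.ofInjective (zpowGroupHom_injective_multiplicative_int hn)))
        ⟨Multiplicative.ofAdd (1 : ℤ) ^ m, Multiplicative.ofAdd 1, rfl⟩
      rw [ofInjective_zpow_apply hm hn] at h
      simp only [map_zpow] at h
      simp [h])

theorem toHNN_x : toHNN hm hn (x m n) = HNNExtension.of (Multiplicative.ofAdd 1) :=
  PresentedGroup.toGroup.of _

theorem toHNN_t : toHNN hm hn (t m n) = HNNExtension.t :=
  PresentedGroup.toGroup.of _

/-- The inverse of `BaumslagSolitar.toHNN`. -/
noncomputable def ofHNN : HNN hm hn →* BaumslagSolitar m n :=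
  HNNExtension.lift (zpowersHom _ (x m n)) (t m n) (by
    rintro ⟨_, z, rfl⟩
    have h := ofInjective_zpow_apply hm hn z
    have h' := congrArg (zpowersHom _ (x m n)) h
    refine Eq.trans ?_ (congrArg (· * t m n) h'.symm)
    change t m n * zpowersHom _ (x m n) (z ^ m) = _
    have e : ∀ k : ℤ, zpowersHom _ (x m n) (z ^ k) = (x m n ^ k) ^ z.toAdd := fun k => by
      rw [map_zpow, zpowersHom_apply, ← zpow_mul, ← zpow_mul, mul_comm]
    -- The relation for a general element of the range is a power of the defining one.
    rw [e, e, ← relation, conj_zpow]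
    group)

/-- Only injectivity of `toHNN` is needed: between discrete groups it is then a closed embedding,
along which a proper action pulls back. -/
theorem ofHNN_toHNN (g : BaumslagSolitar m n) : ofHNN hm hn (toHNN hm hn g) = g := by
  have : (ofHNN hm hn).comp (toHNN hm hn) = MonoidHom.id _ := by
    refine PresentedGroup.ext fun b => ?_
    cases b
    · change ofHNN hm hn (toHNN hm hn (x m n)) = x m n
      rw [toHNN_x]; simp [ofHNN]
    · change ofHNN hm hn (toHNN hm hn (t m n)) = t m n
      rw [toHNN_t]; simp [ofHNN]
  exact DFunLike.congr_fun this g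

theorem isATMenable_HNN : IsATMenable (HNN hm hn) := by
  have h : ∀ {k : ℤ}, k ≠ 0 → IsOpenEmbedding
      (zpowGroupHom k : Multiplicative ℤ →* Multiplicative ℤ) := fun hk =>
    .of_continuous_injective_isOpenMap continuous_of_discreteTopology
      (zpowGroupHom_injective_multiplicative_int hk) fun _ _ => isOpen_discrete _
  refine HNNOfInclusions.isATMenable isATMenable_multiplicative_real (h hm) (h hn)
    (finiteIndex_range_zpowGroupHom_multiplicative_int hm)
    (finiteIndex_range_zpowGroupHom_multiplicative_int hn)
    (AddMonoidHom.toMultiplicative (Int.castAddHom ℝ)) Int.isClosedEmbedding_coe_real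
    (realScaling (n / m) (div_ne_zero (Int.cast_ne_zero.2 hn) (Int.cast_ne_zero.2 hm)))
    fun z => Multiplicative.toAdd.injective ?_
  have hm' : (m : ℝ) ≠ 0 := Int.cast_ne_zero.2 hm
  change (n / m : ℝ) * ((m • z.toAdd : ℤ) : ℝ) = ((n • z.toAdd : ℤ) : ℝ)
  push_cast [smul_eq_mul]
  field_simp

instance : DiscreteTopology (HNN hm hn) := by
  have h := HNNExtension.isOpenEmbedding_of
    (φ := (MonoidHom.ofInjective (zpowGroupHom_injective_multiplicative_int hm)).symm.trans
      (MonoidHom.ofInjective (zpowGroupHom_injective_multiplicative_int hn)))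
    (isOpen_discrete _) (isOpen_discrete _) continuous_of_discreteTopology
    continuous_of_discreteTopology
  refine discreteTopology_of_isOpen_singleton_one ?_
  have := h.isOpenMap {1} (isOpen_discrete _)
  simpa using this

instance : DiscreteTopology (BaumslagSolitar m n) := ⟨rfl⟩

theorem isATMenable (hm : m ≠ 0) (hn : n ≠ 0) : IsATMenable (BaumslagSolitar m n) := by
  obtain ⟨-, -, -, -, V, i1, i2, i3, α, hα⟩ := isATMenable_HNN hm hn
  have hinj : Function.Injective (toHNN hm hn) :=
    Function.LeftInverse.injective (ofHNN_toHNN hm hn)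
  have hclosed : IsClosedEmbedding (toHNN hm hn) :=
    .of_continuous_injective_isClosedMap continuous_of_discreteTopology hinj
      fun _ _ => isClosed_discrete _
  have hcount : Countable (BaumslagSolitar m n) :=
    (QuotientGroup.mk'_surjective _ :
      Function.Surjective (QuotientGroup.mk' (Subgroup.normalClosure
        ({FreeGroup.of true * FreeGroup.of false ^ m * (FreeGroup.of true)⁻¹ *
          (FreeGroup.of false ^ n)⁻¹} : Set (FreeGroup Bool))))).countable
  refine ⟨inferInstance, inferInstance, inferInstance, inferInstance, V, i1, i2, i3,
    α.comp (toHNN hm hn), fun v => ⟨continuous_of_discreteTopology, ?_⟩⟩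
  exact (hα v).2.comp hclosed.isProperMap

end BaumslagSolitar

theorem BaumslagSolitar.isCompactlyGeneratedGroup (m n : ℤ) :
    IsCompactlyGeneratedGroup (BaumslagSolitar m n) :=
  ⟨{x m n, t m n}, (Set.toFinite _).isCompact, closure_generators m n⟩

theorem theorem7p2 :
    (∀ (𝔑 : Type u) [Group 𝔑] [TopologicalSpace 𝔑] [IsTopologicalGroup 𝔑]
        [T2Space 𝔑] [LocallyCompactSpace 𝔑]
        (G : Subgroup 𝔑)
        (H : Type*) [Group H] [TopologicalSpace H] [IsTopologicalGroup H]
        (i₁ i₂ : H →* G)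
        (hi₁ : Topology.IsOpenEmbedding i₁) (hi₂ : Topology.IsOpenEmbedding i₂)
        (φ : 𝔑 ≃ₜ* 𝔑),
        IsCompactlyGeneratedGroup 𝔑 →
        IsClosed (G : Set 𝔑) →
        i₁.range.FiniteIndex → i₂.range.FiniteIndex →
        (∀ h : H, φ (i₁ h : 𝔑) = (i₂ h : 𝔑)) →
        IsATMenable 𝔑 →
        IsATMenable (HNNOfInclusions i₁ i₂ hi₁.injective hi₂.injective) ∧
        (IsCompactlyGeneratedGroup G →
          IsCompactlyGeneratedGroup (HNNOfInclusions i₁ i₂ hi₁.injective hi₂.injective))) ∧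
    (∀ m n : ℤ, m ≠ 0 → n ≠ 0 →
      IsATMenable (BaumslagSolitar m n) ∧
      IsCompactlyGeneratedGroup (BaumslagSolitar m n)) :=
  ⟨fun _ _ _ _ _ _ G _ _ _ _ _ _ hi₁ hi₂ φ _ hG hf₁ hf₂ hφ h𝔑 =>
    ⟨HNNOfInclusions.isATMenable h𝔑 hi₁ hi₂ hf₁ hf₂ G.subtype hG.isClosedEmbedding_subtypeVal φ hφ,
      HNNExtension.isCompactlyGeneratedGroup⟩,
    fun m n hm hn => ⟨BaumslagSolitar.isATMenable hm hn,
      BaumslagSolitar.isCompactlyGeneratedGroup m n⟩⟩
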